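/- **Setting.** Let $(\Omega,\mathscr F,\mathcal P)$ be a probability space, $\mathcal Z=[a,b]^M$ with $a<b$, and let $(X_t)_{t\ge -1}$ be a stationary, time-homogeneous Markov process in $\mathbb R^M$ with transition kernel $\mathcal K(\cdot\,|\,\cdot)$: its initial law $\nu=\mathcal P_{X_{-1}}$ is invariant for $\mathcal K$, and $X_t\in\mathcal Z$ almost surely for all $t$. The observations $y_t\in\mathbb R^N$, $t\ge 0$, are conditionally independent given the state process, with conditional laws $\mathcal N(\mu_t(X_t),C_t(X_t))$, where $C_t(x)=\Sigma_t(x)+\sigma^2 I$, $\sigma\ge 0$, and $\Sigma_t(x)$ is positive definite for $x\in\mathcal Z$. Assume that $\|\mu_t(x)\|_2$ and $\lambda_{\max}(C_t(x))$ are bounded above uniformly in $t\ge 0$, $x\in\mathcal Z$, that $\lambda_{\inf}=\inf_{t,x}\lambda_{\min}(C_t(x))>1$, and that the $\mu_t$ and the entries of the $\Sigma_t$ are Lipschitz on $\mathcal Z$ with respect to $\|\cdot\|_1$, uniformly in $t$. Let $\mathscr Y_t=\sigma(y_0,\dots,y_t)$. **Quantization.** For $L\ge 1$ divide $[a,b]$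 into $L$ intervals of equal length (half-open, the last one closed), and $\mathcal Z$ into the $L_S=L^M$ product cells $\mathcal Z^1,\dots,\mathcal Z^{L_S}$ with centres $x^1,\dots,x^{L_S}$. Let $\mathbf X=[x^1\cdots x^{L_S}]$, let $X^{L}_t$ be the centre of the cell which contains $X_t$, and set $$P(i,j)=\mathcal P(X^L_0=x^i\mid X^L_{-1}=x^j),\qquad E_{-1}(j)=\mathcal P(X^L_{-1}=x^j)$$ (with $P(i,j)=0$ if the condition has probability $0$), $\mathsf L_t(x,v)=(2\pi)^{N/2}\,\mathcal N(v;\mu_t(x),C_t(x))$, where $\mathcal N(v;\mu,C)$ is the Gaussian density, and $\mathbf\Lambda_t=\mathrm{diag}(\mathsf L_t(x^1,y_t),\dots,\mathsf L_t(x^{L_S},y_t))$. **Conditional regularity.** For $X\sim\nu$ and a cell $\mathcal Z^j$ of positive probability put $\mathcal K(A\,|\in\mathcal Z^j)=\mathbb E[\mathcal K(A|X)\mid X\in\mathcal Z^j]$. The kernel is CRT I if there is a $\nu$-uniformly integrable sequence of functions $\delta_n\ge 0$, converging to $0$ $\nu$-a.e., such that for all $L\ge1$ and $\nu$-almost all $x$,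 with $\mathcal Z^j$ the cell of $x$, $$\max_i\big|\mathcal K(\mathcal Z^i|x)-\mathcal K(\mathcal Z^i\,|\in\mathcal Z^j)\big|\le \delta_{L_S}(x)/L_S .$$ It is CRT II if $\mathcal K(\cdot|x)$ has, for $\nu$-almost all $x$, a density $\kappa(\cdot|x)$ with respect to Lebesgue measure ($\kappa\ge 0$ jointly measurable), and there is such a sequence $\delta_n$ with $$\operatorname*{ess\,sup}_{v}\big|\kappa(v|x)-\mathbb E[\kappa(v|X)\mid X\in\mathcal Z^j]\big|\le\delta_{L_S}(x)$$ for all $L\ge 1$ and $\nu$-almost all $x$, with $\mathcal Z^j$ the cell of $x$. Assume that the kernel is CRT I or CRT II. **The approximate filter.** For a horizon $T\ge 0$ let $\widetilde{\mathcal P}$ be the reference measure up to time $T$, given by $d\mathcal P/d\widetilde{\mathcal P}=\prod_{t\le T}\mathcal N(y_t;\mu_t(X_t),C_t(X_t))/\mathcal N(y_t;0,I)$. On an enlargement of the space let $Z_{-1},\dots,Z_T$ be a Markov chain on the standard basis $e_1,\dots,e_{L_S}$ of $\mathbb R^{L_S}$ with initial distribution $E_{-1}$ and transition matrix $P$, independent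 of state and observations under $\widetilde{\mathcal P}$. Put $\Lambda^Z_t=\prod_{i=0}^t\mathsf L_i(\mathbf X Z_i,y_i)$ and $$\widetilde{\mathcal E}^{L}(X_t|\mathscr Y_t)=\frac{\mathbf X\,\mathbb E_{\widetilde{\mathcal P}}[Z_t\Lambda^Z_t\mid\mathscr Y_t]}{\mathbb E_{\widetilde{\mathcal P}}[\Lambda^Z_t\mid\mathscr Y_t]} .$$ **Theorem (the marginal filter).** 1. $P$ does not depend on time: for all $t\ge0$ and all $i,j$, $P(i,j)=\mathcal P(X^L_t=x^i\mid X^L_{t-1}=x^j)=\mathcal P(X_t\in\mathcal Z^i\mid X_{t-1}\in\mathcal Z^j)$. 2. Define $E_t$, $t\ge 0$, by the linear recursion $E_t=\mathbf\Lambda_t P E_{t-1}$ started at $E_{-1}$. For all $L\ge 1$ and $0\le t\le T$, almost surely, $\mathbb E_{\widetilde{\mathcal P}}[Z_t\Lambda^Z_t\mid\mathscr Y_t]=E_t$, $\|E_t\|_1>0$ and $$\widetilde{\mathcal E}^{L}(X_t|\mathscr Y_t)=\frac{\mathbf X E_t}{\|E_t\|_1}.$$ 3. The filter is asymptotically optimal: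 for all $T\ge 0$ and all real $C\ge1$ there is a measurable set $\widehat\Omega_T\subseteq\Omega$ with $\mathcal P(\widehat\Omega_T)\ge 1-(T+1)^{1-CN}e^{-CN}$ such that $$\sup_{0\le t\le T}\ \sup_{\omega\in\widehat\Omega_T}\Big\|\frac{\mathbf X E_t}{\|E_t\|_1}-\mathbb E_{\mathcal P}[X_t\mid\mathscr Y_t]\Big\|_1(\omega)\longrightarrow 0\qquad(L\to\infty),$$ and the same holds with $\widetilde{\mathcal E}^{L}(X_t|\mathscr Y_t)$ in place of $\mathbf X E_t/\|E_t\|_1$ (given any versions of the conditional expectations). -/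

import Mathlib

open MeasureTheory ProbabilityTheory Filter Topology
open scoped ENNReal Matrix

noncomputable section

namespace GridFilter

/-! ### The partially observed system -/

/-- The `ℓ₁`-norm of a finite real vector. -/
def l1 {ι : Type*} [Fintype ι] (v : ι → ℝ) : ℝ := ∑ i, |v i|

/-- The multivariate Gaussian density `𝒩(v; m, C)` as a function of `v`. -/
def gaussPdf {N : ℕ} (m : Fin N → ℝ) (C : Matrix (Fin N) (Fin N) ℝ) (v : Fin N → ℝ) : ℝ :=
  (√((2 * Real.pi) ^ N * C.det))⁻¹ * Real.exp (-(1 / 2) * ((v - m) ⬝ᵥ (C⁻¹ *ᵥ (v - m))))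

/-- The (nondegenerate) multivariate Gaussian law `𝒩(m, C)`. -/
def gaussLaw {N : ℕ} (m : Fin N → ℝ) (C : Matrix (Fin N) (Fin N) ℝ) : Measure (Fin N → ℝ) :=
  volume.withDensity fun v => ENNReal.ofReal (gaussPdf m C v)

/-- The data of the system: the cube `[a, b]^M` which supports the state, the time invariant
transition kernel of the state, the conditional means `μ_t` and covariances `Σ_t` of the
observations, and the noise level `σ`. Only the values of `mean t` and `cov t` on the cube
matter. -/
structure System (M N : ℕ) where
  a : ℝ
  b : ℝ
  kernel : Kernel (Fin M → ℝ) (Fin M → ℝ)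
  mean : ℕ → (Fin M → ℝ) → (Fin N → ℝ)
  cov : ℕ → (Fin M → ℝ) → Matrix (Fin N) (Fin N) ℝ
  sigma : ℝ

variable {M N : ℕ} {Ω : Type*} [MeasurableSpace Ω]

/-- The state space `𝒵 = [a, b]^M`. -/
def System.cube (S : System M N) : Set (Fin M → ℝ) :=
  Set.univ.pi fun _ => Set.Icc S.a S.b

/-- `C_t(x) = Σ_t(x) + σ² I`. -/
def System.obsCov (S : System M N) (t : ℕ) (x : Fin M → ℝ) : Matrix (Fin N) (Fin N) ℝ :=
  S.cov t x + (S.sigma ^ 2) • (1 : Matrix (Fin N) (Fin N) ℝ)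

/-- The standing assumptions on the data: positive definiteness of `Σ_t`; boundedness, with
`λ_max (C_t(x)) ≤ λ_sup`, `‖μ_t(x)‖₂ ≤ μ_sup` and `λ_inf ≤ λ_min (C_t(x))` for some `λ_inf > 1`
(the bounds on eigenvalues are written in the Loewner order); and Lipschitz continuity of
`μ_t` and, elementwise, of `Σ_t` with respect to the `ℓ₁`-norm; all uniformly in time. -/
structure System.Regular (S : System M N) : Prop where
  lt : S.a < S.b
  markov : IsMarkovKernel S.kernel
  sigma_nonneg : 0 ≤ S.sigma
  cov_posDef : ∀ t, ∀ x ∈ S.cube, (S.cov t x).PosDef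
  mean_bounded : ∃ muSup : ℝ, ∀ t, ∀ x ∈ S.cube, √(∑ i, (S.mean t x i) ^ 2) ≤ muSup
  eig_upper : ∃ lamSup : ℝ, ∀ t, ∀ x ∈ S.cube,
    (lamSup • (1 : Matrix (Fin N) (Fin N) ℝ) - S.obsCov t x).PosSemidef
  eig_lower : ∃ lamInf : ℝ, 1 < lamInf ∧ ∀ t, ∀ x ∈ S.cube,
    (S.obsCov t x - lamInf • (1 : Matrix (Fin N) (Fin N) ℝ)).PosSemidef
  mean_lipschitz : ∃ Kmu : ℝ, ∀ t, ∀ x ∈ S.cube, ∀ x' ∈ S.cube,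
    l1 (S.mean t x - S.mean t x') ≤ Kmu * l1 (x - x')
  cov_lipschitz : ∃ Kcov : ℝ, ∀ t, ∀ x ∈ S.cube, ∀ x' ∈ S.cube, ∀ i j,
    |S.cov t x i j - S.cov t x' i j| ≤ Kcov * l1 (x - x')

/-- The σ-algebra generated by `Z 0, …, Z t`. -/
abbrev history {β : Type*} [MeasurableSpace β] (Z : ℕ → Ω → β) (t : ℕ) : MeasurableSpace Ω :=
  ⨆ s ≤ t, MeasurableSpace.comap (Z s) inferInstance

/-- `X`, `y` are a state process and an observation process of the system `S` on `(Ω, P)`.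
The state carries the times `-1, 0, 1, …`, so that its time index is shifted by one:
`X 0` is the initial value `X_{-1}` and `X (t + 1)` is `X_t`. The state is a stationary Markov
process with the kernel of `S`, almost surely in the cube; conditionally on the whole state
process, the observations `y t` are independent, with laws `𝒩(μ_t(X_t), C_t(X_t))`. -/
structure IsRealization (S : System M N) (P : Measure Ω) (X : ℕ → Ω → (Fin M → ℝ))
    (y : ℕ → Ω → (Fin N → ℝ)) : Prop where
  measurable_state : ∀ t, Measurable (X t)
  measurable_obs : ∀ t, Measurable (y t)
  mem_cube : ∀ t, ∀ᵐ ω ∂P, X t ω ∈ S.cube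
  invariant : S.kernel.Invariant (P.map (X 0))
  markov_property : ∀ (t : ℕ) (A : Set (Fin M → ℝ)) (G : Set Ω), MeasurableSet A →
    MeasurableSet[history X t] G →
      P (G ∩ X (t + 1) ⁻¹' A) = ∫⁻ ω in G, S.kernel (X t ω) A ∂P
  obs_law : ∀ (T : ℕ) (A : Set (ℕ → Fin M → ℝ)) (B : ℕ → Set (Fin N → ℝ)),
    MeasurableSet A → (∀ t, MeasurableSet (B t)) →
      P ({ω | (fun s => X s ω) ∈ A} ∩ ⋂ t ∈ Finset.range (T + 1), y t ⁻¹' B t) =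
        ∫⁻ ω in {ω | (fun s => X s ω) ∈ A}, ∏ t ∈ Finset.range (T + 1),
          gaussLaw (S.mean t (X (t + 1) ω)) (S.obsCov t (X (t + 1) ω)) (B t) ∂P

/-! ### Uniform quantization of the cube, and the marginal quantization of the state -/

/-- The `l`-th interval of the uniform partition of `[a, b]` into `L` intervals of length
`(b - a) / L`, half-open except for the last one, which is closed. -/
def interval (a b : ℝ) (L : ℕ) (l : Fin L) : Set ℝ :=
  if (l : ℕ) + 1 = L then Set.Icc (a + l * ((b - a) / L)) b
  else Set.Ico (a + l * ((b - a) / L)) (a + (l + 1) * ((b - a) / L))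

/-- The multi-indices of the cells of the grid; there are `L_S = L ^ M` of them. -/
abbrev Idx (M L : ℕ) : Type := Fin M → Fin L

/-- The quantization region `𝒵^j`. -/
def System.cell (S : System M N) (L : ℕ) (j : Idx M L) : Set (Fin M → ℝ) :=
  Set.univ.pi fun m => interval S.a S.b L (j m)

/-- The reconstruction point `x^j`: the centre of the cell `𝒵^j`. -/
def System.center (S : System M N) (L : ℕ) (j : Idx M L) : Fin M → ℝ :=
  fun m => S.a + ((j m : ℝ) + 1 / 2) * ((S.b - S.a) / L)

open Classical in
/-- The quantizer `𝒬`: it maps the points of the cell `𝒵^j` to the centre `x^j` (and, as a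
convention, the points outside of the cube to `0`). -/
def System.quantize (S : System M N) (L : ℕ) (x : Fin M → ℝ) : Fin M → ℝ :=
  ∑ j : Idx M L, if x ∈ S.cell L j then S.center L j else 0

/-- The marginal quantization of the state, with the same shift of time as the state. -/
def marginal (S : System M N) (L : ℕ) (X : ℕ → Ω → (Fin M → ℝ)) (t : ℕ) (ω : Ω) :
    Fin M → ℝ :=
  S.quantize L (X t ω)

/-- The one step transition probabilities of the marginal quantization `X^L` of the state,
`P(i, j) = 𝒫(X^L_0 = x^i | X^L_{-1} = x^j)`. -/
def transMatrix (S : System M N) (P : Measure Ω) (X : ℕ → Ω → (Fin M → ℝ)) (L : ℕ) :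
    Matrix (Idx M L) (Idx M L) ℝ :=
  Matrix.of fun i j =>
    (ProbabilityTheory.cond P {ω | marginal S L X 0 ω = S.center L j}).real
      {ω | marginal S L X 1 ω = S.center L i}

/-- The initial vector `E_{-1}`, the expectation of the standard basis vector which encodes the
quantized initial state; its entries are the probabilities `𝒫(X^L_{-1} = x^j)`. -/
def initVec (S : System M N) (P : Measure Ω) (X : ℕ → Ω → (Fin M → ℝ)) (L : ℕ) :
    Idx M L → ℝ :=
  fun j => P.real {ω | marginal S L X 0 ω = S.center L j}

/-! ### Conditional regularity of the transition kernel -/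

/-- The cumulative kernel `𝒦(A | ∈ B) = 𝔼[𝒦(A | X) | X ∈ B]`, for `X` with law `ν`. -/
def cumKernel (K : Kernel (Fin M → ℝ) (Fin M → ℝ)) (ν : Measure (Fin M → ℝ))
    (A B : Set (Fin M → ℝ)) : ℝ :=
  (∫ θ in B, (K θ).real A ∂ν) / ν.real B

/-- The cumulative kernel density `κ(y | ∈ B) = 𝔼[κ(y | X) | X ∈ B]`, for `X` with law `ν`. -/
def cumDensity (κ : (Fin M → ℝ) → (Fin M → ℝ) → ℝ) (ν : Measure (Fin M → ℝ))
    (y : Fin M → ℝ) (B : Set (Fin M → ℝ)) : ℝ :=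
  (∫ θ in B, κ y θ ∂ν) / ν.real B

/-- Conditional regularity of type I, with respect to the law `ν` of the state. -/
def IsCRT1 (S : System M N) (ν : Measure (Fin M → ℝ)) : Prop :=
  ∃ δ : ℕ → (Fin M → ℝ) → ℝ,
    (∀ n x, 0 ≤ δ n x) ∧ UniformIntegrable δ 1 ν ∧
    (∀ᵐ x ∂ν, Tendsto (fun n => δ n x) atTop (𝓝 0)) ∧
    ∀ L : ℕ, 1 ≤ L → ∀ᵐ x ∂ν, ∀ j : Idx M L, x ∈ S.cell L j → ∀ i : Idx M L,
      |(S.kernel x).real (S.cell L i) - cumKernel S.kernel ν (S.cell L i) (S.cell L j)|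
        ≤ δ (L ^ M) x / (L : ℝ) ^ M

/-- Conditional regularity of type II, with respect to the law `ν` of the state; `κ y x` is the
density at `y` of the kernel at `x`. -/
def IsCRT2 (S : System M N) (ν : Measure (Fin M → ℝ)) : Prop :=
  ∃ κ : (Fin M → ℝ) → (Fin M → ℝ) → ℝ,
    Measurable (Function.uncurry κ) ∧ (∀ y x, 0 ≤ κ y x) ∧
    (∀ᵐ x ∂ν, S.kernel x = volume.withDensity fun y => ENNReal.ofReal (κ y x)) ∧
    ∃ δ : ℕ → (Fin M → ℝ) → ℝ,
      (∀ n x, 0 ≤ δ n x) ∧ UniformIntegrable δ 1 ν ∧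
      (∀ᵐ x ∂ν, Tendsto (fun n => δ n x) atTop (𝓝 0)) ∧
      ∀ L : ℕ, 1 ≤ L → ∀ᵐ x ∂ν, ∀ j : Idx M L, x ∈ S.cell L j →
        ∀ᵐ y ∂(volume : Measure (Fin M → ℝ)), |κ y x - cumDensity κ ν y (S.cell L j)| ≤ δ (L ^ M) x

/-! ### The recursive grid filter -/

/-- The likelihood `L_t(x, v) = (√(2π))^N 𝒩(v; μ_t(x), C_t(x))`. -/
def System.lik (S : System M N) (t : ℕ) (x : Fin M → ℝ) (v : Fin N → ℝ) : ℝ :=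
  (√(2 * Real.pi)) ^ N * gaussPdf (S.mean t x) (S.obsCov t x) v

/-- The diagonal likelihood matrix `Λ_t`, for the observation `v` at time `t`. -/
def System.likMatrix (S : System M N) (L : ℕ) (t : ℕ) (v : Fin N → ℝ) :
    Matrix (Idx M L) (Idx M L) ℝ :=
  Matrix.diagonal fun j => S.lik t (S.center L j) v

/-- The reconstruction matrix, whose columns are the reconstruction points. -/
def System.recon (S : System M N) (L : ℕ) : Matrix (Fin M) (Idx M L) ℝ :=
  Matrix.of fun m j => S.center L j m

/-- The linear recursion `E_t = Λ_t P E_{t-1}`, started at `E_{-1}`. The time index is shifted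
by one: `gridE 0` is `E_{-1}` and `gridE (t + 1)` is `E_t`. -/
def gridE (S : System M N) (P : Measure Ω) (X : ℕ → Ω → (Fin M → ℝ))
    (y : ℕ → Ω → (Fin N → ℝ)) (L : ℕ) : ℕ → Ω → (Idx M L → ℝ)
  | 0, _ => initVec S P X L
  | t + 1, ω =>
      S.likMatrix L t (y t ω) *ᵥ (transMatrix S P X L *ᵥ gridE S P X y L t ω)

/-- The recursive grid based estimate of `X_t`, namely `𝐗 E_t / ‖E_t‖₁`. -/
def gridFilter (S : System M N) (P : Measure Ω) (X : ℕ → Ω → (Fin M → ℝ))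
    (y : ℕ → Ω → (Fin N → ℝ)) (L t : ℕ) (ω : Ω) : Fin M → ℝ :=
  (l1 (gridE S P X y L (t + 1) ω))⁻¹ • (S.recon L *ᵥ gridE S P X y L (t + 1) ω)

/-- The optimal (MMSE) filter `𝔼[X_t | y_0, …, y_t]`. -/
def mmse (P : Measure Ω) (X : ℕ → Ω → (Fin M → ℝ)) (y : ℕ → Ω → (Fin N → ℝ)) (t : ℕ) :
    Ω → (Fin M → ℝ) :=
  condExp (history y t) P (X (t + 1))

/-! ### The reference measure, the auxiliary chain and the approximate filter -/

/-- The likelihood ratio of the observations up to time `T`: the product over `t ≤ T` of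
`𝒩(y_t; μ_t(X_t), C_t(X_t)) / 𝒩(y_t; 0, I)`. -/
def likRatio (S : System M N) (X : ℕ → Ω → (Fin M → ℝ)) (y : ℕ → Ω → (Fin N → ℝ)) (T : ℕ)
    (ω : Ω) : ℝ :=
  ∏ t ∈ Finset.range (T + 1),
    gaussPdf (S.mean t (X (t + 1) ω)) (S.obsCov t (X (t + 1) ω)) (y t ω) / gaussPdf 0 1 (y t ω)

/-- The reference measure up to the horizon `T`, whose density with respect to `P` is the
inverse of the likelihood ratio. -/
def refMeasure (S : System M N) (P : Measure Ω) (X : ℕ → Ω → (Fin M → ℝ))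
    (y : ℕ → Ω → (Fin N → ℝ)) (T : ℕ) : Measure Ω :=
  P.withDensity fun ω => ENNReal.ofReal (likRatio S X y T ω)⁻¹

/-- The law of the path `(Z_{-1}, Z_0, …, Z_T)` of the Markov chain on the cells with initial
distribution `E_{-1}` and transition matrix `P`. A path `z` has `z 0 = Z_{-1}` and
`z (t + 1) = Z_t`, and the state `j` of the chain stands for the basis vector `e_j`. -/
def chainLaw (S : System M N) (P : Measure Ω) (X : ℕ → Ω → (Fin M → ℝ)) (L T : ℕ) :
    Measure (Fin (T + 2) → Idx M L) :=
  ∑ z : Fin (T + 2) → Idx M L,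
    ENNReal.ofReal (initVec S P X L (z 0) *
      ∏ k : Fin (T + 1), transMatrix S P X L (z k.succ) (z k.castSucc)) • Measure.dirac z

/-- The reference measure of the state, the observations and the chain: under it, the chain is
independent of the state and of the observations. -/
def auxMeasure (S : System M N) (P : Measure Ω) (X : ℕ → Ω → (Fin M → ℝ))
    (y : ℕ → Ω → (Fin N → ℝ)) (L T : ℕ) : Measure (Ω × (Fin (T + 2) → Idx M L)) :=
  (refMeasure S P X y T).prod (chainLaw S P X L T)

/-- The likelihood functional of the chain, the product over `i ≤ t` of `L_i(Z_i, y_i)`. -/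
def auxLik (S : System M N) (y : ℕ → Ω → (Fin N → ℝ)) (L T : ℕ) (t : Fin (T + 1))
    (p : Ω × (Fin (T + 2) → Idx M L)) : ℝ :=
  ∏ i ∈ Finset.Iic t, S.lik i (S.center L (p.2 i.succ)) (y i p.1)

/-- The σ-algebra of `y_0, …, y_t` on the space which also carries the chain. -/
abbrev auxHistory (y : ℕ → Ω → (Fin N → ℝ)) (β : Type*) (t : ℕ) : MeasurableSpace (Ω × β) :=
  (history y t).comap Prod.fst

/-- The unnormalized conditional expectation of `Z_t`, weighted by the likelihood functional of
the chain, under the reference measure, given `y_0, …, y_t`. -/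
def auxE (S : System M N) (P : Measure Ω) (X : ℕ → Ω → (Fin M → ℝ))
    (y : ℕ → Ω → (Fin N → ℝ)) (L T : ℕ) (t : Fin (T + 1)) :
    Ω × (Fin (T + 2) → Idx M L) → (Idx M L → ℝ) :=
  condExp (auxHistory y (Fin (T + 2) → Idx M L) t) (auxMeasure S P X y L T)
    fun p => auxLik S y L T t p • (Pi.single (p.2 t.succ) (1 : ℝ) : Idx M L → ℝ)

/-- The conditional expectation of the likelihood functional of the chain under the reference
measure, given `y_0, …, y_t`. -/
def auxNorm (S : System M N) (P : Measure Ω) (X : ℕ → Ω → (Fin M → ℝ))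
    (y : ℕ → Ω → (Fin N → ℝ)) (L T : ℕ) (t : Fin (T + 1)) :
    Ω × (Fin (T + 2) → Idx M L) → ℝ :=
  condExp (auxHistory y (Fin (T + 2) → Idx M L) t) (auxMeasure S P X y L T)
    fun p => auxLik S y L T t p

/-- The approximate filter which is defined by the auxiliary chain. -/
def auxFilter (S : System M N) (P : Measure Ω) (X : ℕ → Ω → (Fin M → ℝ))
    (y : ℕ → Ω → (Fin N → ℝ)) (L T : ℕ) (t : Fin (T + 1))
    (p : Ω × (Fin (T + 2) → Idx M L)) : Fin M → ℝ :=
  (auxNorm S P X y L T t p)⁻¹ • (S.recon L *ᵥ auxE S P X y L T t p)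

end GridFilter

end

open GridFilter

open MeasureTheory ProbabilityTheory Filter Topology
open scoped ENNReal Matrix

noncomputable section

namespace GridFilter

variable {M N : ℕ} {Ω : Type*} [MeasurableSpace Ω]

/-! ### Geometry of the grid -/

/-! Fix the observation path. By Bayes' formula (`condExp_eq_of_joint_density`, applied to the joint
density of `map_path_obs`) the optimal filter is a quotient of two integrals against an unnormalized
measure `μ_t`, with `μ_{t+1} = ℓ_t · (μ_t K)` and `μ_0 = ν`. The grid recursion is the discrete
version of this: `K` is replaced by its cell averages and `ℓ_t` by its values at the centres.

The error is the `ℓ₁` distance between the grid vector and the cell masses of `μ_t`. One step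
(`grid_step_error`) passes on the old error without amplification, because the matrix has column
sums at most `1` and the likelihoods are at most `1`. It adds the oscillation of `ℓ_t` on the cells,
which vanishes by uniform continuity on the compact cube, and the error of the cell-averaged kernel.
Since `λ_inf > 1` gives `ℓ_t ≤ 1` and `ν` is invariant, `μ_t ≤ ν` at every time (`unnormFilter_le`).
The kernel error is therefore at most a `ν`-integral, which tends to `0` by conditional regularity
and Vitali's theorem. Numerator and denominator converge, the limit of the denominator is positive,
and so the grid filter converges almost surely; Egorov's theorem makes the convergence uniform off a
set of any prescribed positive probability.

For the auxiliary chain, independence turns the conditional expectations into finite sums over paths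
(`condExp_prod_finite`). `sum_chainWeight_lik` evaluates these by the matrix recursion: the steps
after time `t` preserve total mass, since invariance keeps the vectors off null cells, where the
matrix has zero columns. Time invariance of the matrix is stationarity (`map_state`). -/

lemma measurableSet_interval (a b : ℝ) (L : ℕ) (l : Fin L) : MeasurableSet (interval a b L l) := by
  unfold interval
  split_ifs
  · exact measurableSet_Icc
  · exact measurableSet_Ico

lemma measurableSet_cell (S : System M N) (L : ℕ) (j : Idx M L) : MeasurableSet (S.cell L j) :=
  MeasurableSet.univ_pi fun _ => measurableSet_interval _ _ _ _

lemma measurableSet_cube (S : System M N) : MeasurableSet S.cube :=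
  MeasurableSet.univ_pi fun _ => measurableSet_Icc

/-- The bounds which every interval of the partition satisfies. -/
lemma mem_interval_bounds {a b : ℝ} {L : ℕ} {l : Fin L} {x : ℝ}
    (hx : x ∈ interval a b L l) :
    a + l * ((b - a) / L) ≤ x ∧ x ≤ a + (l + 1) * ((b - a) / L) ∧
      ((l : ℕ) + 1 ≠ L → x < a + (l + 1) * ((b - a) / L)) := by
  unfold interval at hx
  have hL : (0 : ℝ) < L := by exact_mod_cast l.pos
  split_ifs at hx with h
  · refine ⟨hx.1, ?_, fun h' => absurd h h'⟩
    have h1 : ((l : ℝ) + 1) = L := by exact_mod_cast h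
    rw [h1, mul_div_cancel₀ _ hL.ne']
    linarith [hx.2]
  · exact ⟨hx.1, hx.2.le, fun _ => hx.2⟩

lemma interval_index_unique {a b : ℝ} (hab : a < b) {L : ℕ} {l l' : Fin L} {x : ℝ}
    (hx : x ∈ interval a b L l) (hx' : x ∈ interval a b L l') : l = l' := by
  have key : ∀ l l' : Fin L, x ∈ interval a b L l → x ∈ interval a b L l' → ¬ l < l' := by
    intro l l' hx hx' hlt
    have hL : (0 : ℝ) < L := by exact_mod_cast l.pos
    have hh : 0 < (b - a) / L := div_pos (by linarith) hL
    -- An index below `l'` is not the last one, so its interval is open on the right.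
    have h1 := (mem_interval_bounds hx).2.2 (by have := l'.2; omega)
    have h2 := (mem_interval_bounds hx').1
    have h3 : ((l : ℝ) + 1) ≤ l' := by exact_mod_cast hlt
    have h4 := mul_le_mul_of_nonneg_right h3 hh.le
    linarith
  exact le_antisymm (not_lt.1 (key _ _ hx' hx)) (not_lt.1 (key _ _ hx hx'))

lemma exists_mem_interval {a b : ℝ} (hab : a < b) {L : ℕ} (hL : 1 ≤ L) {x : ℝ}
    (hx : x ∈ Set.Icc a b) : ∃ l : Fin L, x ∈ interval a b L l := by
  have hL0 : (0 : ℝ) < L := by exact_mod_cast hL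
  set h : ℝ := (b - a) / L with hh
  have hpos : 0 < h := div_pos (by linarith) hL0
  have h0 : 0 ≤ (x - a) / h := div_nonneg (by linarith [hx.1]) hpos.le
  -- The floor is the index unless it is at least `L - 1`; at `x = b` it equals `L`, one too many.
  -- All these cases go to the last, closed interval.
  by_cases hk : ⌊(x - a) / h⌋₊ + 1 < L
  · refine ⟨⟨⌊(x - a) / h⌋₊, by omega⟩, ?_⟩
    have h1 := Nat.floor_le h0
    have h2 := Nat.lt_floor_add_one ((x - a) / h)
    rw [le_div_iff₀ hpos] at h1
    rw [div_lt_iff₀ hpos] at h2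
    unfold interval
    rw [if_neg (by simp only; omega)]
    exact ⟨by simp only [← hh]; linarith, by simp only [← hh]; linarith⟩
  · refine ⟨⟨L - 1, by omega⟩, ?_⟩
    have h1 : ((L - 1 : ℕ) : ℝ) ≤ ⌊(x - a) / h⌋₊ := by exact_mod_cast (by omega)
    have h2 := h1.trans (Nat.floor_le h0)
    rw [le_div_iff₀ hpos] at h2
    unfold interval
    rw [if_pos (by simp only; omega)]
    exact ⟨by simp only [← hh]; linarith, hx.2⟩

lemma interval_subset {a b : ℝ} (hab : a < b) {L : ℕ} (l : Fin L) :
    interval a b L l ⊆ Set.Icc a b := by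
  intro x hx
  have hL : (0 : ℝ) < L := by exact_mod_cast l.pos
  have hh : 0 < (b - a) / L := div_pos (by linarith) hL
  obtain ⟨h1, h2, -⟩ := mem_interval_bounds hx
  have h3 : ((l : ℝ) + 1) ≤ L := by exact_mod_cast l.2
  have h4 := mul_le_mul_of_nonneg_right h3 hh.le
  rw [mul_div_cancel₀ _ hL.ne'] at h4
  have h5 : 0 ≤ (l : ℝ) * ((b - a) / L) := by positivity
  exact ⟨by linarith, by linarith⟩

lemma center_mem_interval {a b : ℝ} (hab : a < b) {L : ℕ} (l : Fin L) :
    a + ((l : ℝ) + 1 / 2) * ((b - a) / L) ∈ interval a b L l := by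
  have hL : (0 : ℝ) < L := by exact_mod_cast l.pos
  have hh : 0 < (b - a) / L := div_pos (by linarith) hL
  unfold interval
  split_ifs with h
  · have h1 : ((l : ℝ) + 1) = L := by exact_mod_cast h
    have h2 : (L : ℝ) * ((b - a) / L) = b - a := mul_div_cancel₀ _ hL.ne'
    rw [← h1] at h2 hh ⊢
    constructor <;> nlinarith
  · constructor <;> nlinarith

section cells

variable {S : System M N} {L : ℕ}

lemma cell_subset_cube (hab : S.a < S.b) (j : Idx M L) : S.cell L j ⊆ S.cube :=
  Set.pi_mono fun m _ => interval_subset hab (j m)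

lemma center_mem_cell (hab : S.a < S.b) (j : Idx M L) : S.center L j ∈ S.cell L j :=
  fun m _ => center_mem_interval hab (j m)

lemma center_mem_cube (hab : S.a < S.b) (j : Idx M L) : S.center L j ∈ S.cube :=
  cell_subset_cube hab j (center_mem_cell hab j)

lemma cell_index_unique (hab : S.a < S.b) {j j' : Idx M L} {x : Fin M → ℝ}
    (hx : x ∈ S.cell L j) (hx' : x ∈ S.cell L j') : j = j' :=
  funext fun m => interval_index_unique hab (hx m trivial) (hx' m trivial)

lemma exists_mem_cell (hab : S.a < S.b) (hL : 1 ≤ L) {x : Fin M → ℝ} (hx : x ∈ S.cube) :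
    ∃ j : Idx M L, x ∈ S.cell L j := by
  choose l hl using fun m => exists_mem_interval hab hL (hx m trivial)
  exact ⟨l, fun m _ => hl m⟩

lemma pairwise_disjoint_cell (hab : S.a < S.b) :
    Pairwise (Function.onFun Disjoint fun j : Idx M L => S.cell L j) := fun _ _ hij =>
  Set.disjoint_left.2 fun _ hx hx' => hij (cell_index_unique hab hx hx')

lemma iUnion_cell (hab : S.a < S.b) (hL : 1 ≤ L) : ⋃ j : Idx M L, S.cell L j = S.cube := by
  refine Set.Subset.antisymm (Set.iUnion_subset fun j => cell_subset_cube hab j) fun x hx => ?_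
  exact Set.mem_iUnion.2 (exists_mem_cell hab hL hx)

lemma center_injective (hab : S.a < S.b) : Function.Injective (S.center L) := fun j j' h =>
  cell_index_unique hab (center_mem_cell hab j) (h ▸ center_mem_cell hab j')

lemma abs_sub_center_le (hab : S.a < S.b) {j : Idx M L} {x : Fin M → ℝ}
    (hx : x ∈ S.cell L j) (m : Fin M) : |x m - S.center L j m| ≤ (S.b - S.a) / L := by
  have hL : (0 : ℝ) < L := by exact_mod_cast (j m).pos
  have hh : 0 < (S.b - S.a) / L := div_pos (by linarith) hL
  obtain ⟨h1, h2, -⟩ := mem_interval_bounds (hx m trivial)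
  simp only [System.center]
  rw [abs_le]
  constructor <;> nlinarith

lemma dist_center_le (hab : S.a < S.b) {j : Idx M L} {x : Fin M → ℝ}
    (hx : x ∈ S.cell L j) : dist x (S.center L j) ≤ (S.b - S.a) / L :=
  (dist_pi_le_iff (div_nonneg (by linarith) (Nat.cast_nonneg L))).2 fun m => by
    rw [Real.dist_eq]; exact abs_sub_center_le hab hx m

lemma sum_measureReal_cell (hab : S.a < S.b) (hL : 1 ≤ L) (μ : Measure (Fin M → ℝ))
    (hμ : μ S.cube ≠ ∞) : ∑ j : Idx M L, μ.real (S.cell L j) = μ.real S.cube := by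
  have h := measure_iUnion (μ := μ) (pairwise_disjoint_cell (L := L) hab)
    (fun j => measurableSet_cell S L j)
  rw [iUnion_cell hab hL, tsum_fintype] at h
  simp only [Measure.real]
  rw [h, ENNReal.toReal_sum fun j _ => ne_top_of_le_ne_top hμ
    (measure_mono (cell_subset_cube hab j))]

lemma sum_setIntegral_cell (hab : S.a < S.b) (hL : 1 ≤ L) {μ : Measure (Fin M → ℝ)}
    (hμ : ∀ᵐ x ∂μ, x ∈ S.cube) {f : (Fin M → ℝ) → ℝ} (hf : Integrable f μ) :
    ∑ j : Idx M L, ∫ x in S.cell L j, f x ∂μ = ∫ x, f x ∂μ := by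
  rw [← integral_iUnion_fintype (fun j => measurableSet_cell S L j) (pairwise_disjoint_cell hab)
    (fun j => hf.integrableOn), iUnion_cell hab hL,
    Measure.restrict_eq_self_of_ae_mem hμ]

lemma quantize_eq_center (hab : S.a < S.b) {j : Idx M L} {x : Fin M → ℝ}
    (hx : x ∈ S.cell L j) : S.quantize L x = S.center L j := by
  classical
  unfold System.quantize
  rw [Finset.sum_eq_single j]
  · rw [if_pos hx]
  · intro i _ hi
    rw [if_neg fun h => hi (cell_index_unique hab h hx)]
  · simp

/-- The point must lie in the cube: outside, the quantizer returns `0`, which may happen to be a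
centre. -/
lemma quantize_eq_center_iff (hab : S.a < S.b) (hL : 1 ≤ L) {j : Idx M L} {x : Fin M → ℝ}
    (hx : x ∈ S.cube) : S.quantize L x = S.center L j ↔ x ∈ S.cell L j := by
  refine ⟨fun h => ?_, quantize_eq_center hab⟩
  obtain ⟨i, hi⟩ := exists_mem_cell hab hL hx
  rw [quantize_eq_center hab hi] at h
  rwa [← center_injective hab h]

lemma measurable_quantize : Measurable (S.quantize L) := by
  classical
  unfold System.quantize
  exact Finset.measurable_sum _ fun j _ =>
    Measurable.ite (measurableSet_cell S L j) measurable_const measurable_const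

end cells

lemma isCompact_cube (S : System M N) : IsCompact S.cube :=
  isCompact_univ_pi fun _ => isCompact_Icc

/-! ### The coordinatewise projection onto the cube -/

/-- The projection of `ℝ^M` onto the cube. -/
def System.clamp (S : System M N) (x : Fin M → ℝ) : Fin M → ℝ := fun m => max S.a (min S.b (x m))

lemma System.clamp_mem {S : System M N} (hab : S.a < S.b) (x : Fin M → ℝ) : S.clamp x ∈ S.cube :=
  fun _ _ => ⟨le_max_left _ _, max_le hab.le (min_le_left _ _)⟩

lemma System.clamp_of_mem {S : System M N} {x : Fin M → ℝ} (hx : x ∈ S.cube) : S.clamp x = x := by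
  funext m
  have := hx m trivial
  simp only [System.clamp]
  rw [min_eq_right this.2, max_eq_right this.1]

lemma System.continuous_clamp (S : System M N) : Continuous S.clamp := by
  unfold System.clamp
  fun_prop

lemma norm_clamp_apply_le {S : System M N} (hab : S.a < S.b) (x : Fin M → ℝ) (m : Fin M) :
    |S.clamp x m| ≤ max |S.a| |S.b| := by
  have := System.clamp_mem hab x m trivial
  exact abs_le_max_abs_abs this.1 this.2

/-! ### The likelihood -/

/-- Evaluating the form at a unit eigenvector shows that each eigenvalue is at least `r ≥ 1`, and
the determinant is their product. -/
lemma one_le_det_of_posSemidef_sub {C : Matrix (Fin N) (Fin N) ℝ} {r : ℝ} (hr : 1 ≤ r)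
    (h : (C - r • (1 : Matrix (Fin N) (Fin N) ℝ)).PosSemidef) (hC : C.IsHermitian) :
    1 ≤ C.det := by
  rw [hC.det_eq_prod_eigenvalues]
  simp only [RCLike.ofReal_real_eq_id, id]
  have h1 : ∀ i, 1 ≤ hC.eigenvalues i := by
    intro i
    have h2 := h.dotProduct_mulVec_nonneg ⇑(hC.eigenvectorBasis i)
    have h3 := hC.eigenvalues_eq i
    have h4 : star ⇑(hC.eigenvectorBasis i) ⬝ᵥ ⇑(hC.eigenvectorBasis i) = (1 : ℝ) := by
      have := hC.eigenvectorBasis.orthonormal.1 i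
      rw [dotProduct_comm, ← EuclideanSpace.inner_eq_star_dotProduct,
        real_inner_self_eq_norm_sq, this, one_pow]
    rw [Matrix.sub_mulVec, dotProduct_sub, Matrix.smul_mulVec, Matrix.one_mulVec,
      dotProduct_smul, h4, smul_eq_mul, mul_one] at h2
    simp only [RCLike.re_to_real] at h3
    linarith
  calc (1 : ℝ) = ∏ _i : Fin N, (1 : ℝ) := by simp
    _ ≤ _ := Finset.prod_le_prod (fun _ _ => zero_le_one) fun i _ => h1 i

section likelihood

variable {S : System M N}

lemma obsCov_posDef (hS : S.Regular) (t : ℕ) {x : Fin M → ℝ} (hx : x ∈ S.cube) :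
    (S.obsCov t x).PosDef :=
  (hS.cov_posDef t x hx).add_posSemidef (Matrix.PosSemidef.one.smul (sq_nonneg _))

lemma one_le_det_obsCov (hS : S.Regular) (t : ℕ) {x : Fin M → ℝ} (hx : x ∈ S.cube) :
    1 ≤ (S.obsCov t x).det := by
  obtain ⟨r, hr, h⟩ := hS.eig_lower
  exact one_le_det_of_posSemidef_sub hr.le (h t x hx) (obsCov_posDef hS t hx).1

lemma gaussPdf_nonneg (m : Fin N → ℝ) (C : Matrix (Fin N) (Fin N) ℝ) (v : Fin N → ℝ) :
    0 ≤ gaussPdf m C v := by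
  unfold gaussPdf; positivity

lemma gaussPdf_pos {C : Matrix (Fin N) (Fin N) ℝ} (hC : 0 < C.det) (m v : Fin N → ℝ) :
    0 < gaussPdf m C v := by
  unfold gaussPdf; positivity

lemma gaussPdf_le {C : Matrix (Fin N) (Fin N) ℝ} (hC : C.PosDef) (hdet : 1 ≤ C.det)
    (m v : Fin N → ℝ) : gaussPdf m C v ≤ ((√(2 * Real.pi)) ^ N)⁻¹ := by
  have h1 : 0 ≤ (v - m) ⬝ᵥ (C⁻¹ *ᵥ (v - m)) := by
    simpa using hC.inv.posSemidef.dotProduct_mulVec_nonneg (v - m)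
  have h2 : (√(2 * Real.pi)) ^ N ≤ √((2 * Real.pi) ^ N * C.det) := by
    rw [← Real.sqrt_sq (by positivity : 0 ≤ (√(2 * Real.pi)) ^ N), ← pow_mul, mul_comm N 2,
      pow_mul, Real.sq_sqrt (by positivity)]
    exact Real.sqrt_le_sqrt (le_mul_of_one_le_right (by positivity) hdet)
  unfold gaussPdf
  calc _ ≤ (√((2 * Real.pi) ^ N * C.det))⁻¹ * 1 :=
        mul_le_mul_of_nonneg_left (Real.exp_le_one_iff.2 (by linarith)) (by positivity)
    _ ≤ _ := by rw [mul_one]; exact inv_anti₀ (by positivity) h2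

lemma measurable_gaussPdf (m : Fin N → ℝ) (C : Matrix (Fin N) (Fin N) ℝ) :
    Measurable (gaussPdf m C) := by
  unfold gaussPdf
  refine Continuous.measurable ?_
  fun_prop

lemma continuousOn_of_abs_sub_le_l1 {f : (Fin M → ℝ) → ℝ} {s : Set (Fin M → ℝ)} {K : ℝ}
    (h : ∀ x ∈ s, ∀ x' ∈ s, |f x - f x'| ≤ K * l1 (x - x')) : ContinuousOn f s := by
  intro x hx
  have hc : Continuous fun z : Fin M → ℝ => K * l1 (z - x) := by
    unfold l1
    simp only [Pi.sub_apply]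
    fun_prop
  have h0 : Tendsto (fun z : Fin M → ℝ => K * l1 (z - x)) (𝓝[s] x) (𝓝 0) := by
    have := hc.tendsto x
    simp only [l1, sub_self, Pi.zero_apply, abs_zero, Finset.sum_const_zero, mul_zero] at this
    exact this.mono_left nhdsWithin_le_nhds
  refine tendsto_iff_dist_tendsto_zero.2 (squeeze_zero' (.of_forall fun _ => dist_nonneg) ?_ h0)
  filter_upwards [self_mem_nhdsWithin] with z hz
  rw [Real.dist_eq]
  exact h z hz x hx

lemma continuousOn_mean (hS : S.Regular) (t : ℕ) : ContinuousOn (S.mean t) S.cube := by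
  obtain ⟨K, hK⟩ := hS.mean_lipschitz
  refine continuousOn_pi.2 fun i =>
    continuousOn_of_abs_sub_le_l1 (K := K) fun x hx x' hx' => ?_
  refine le_trans ?_ (hK t x hx x' hx')
  exact Finset.single_le_sum (f := fun i => |(S.mean t x - S.mean t x') i|)
    (fun _ _ => abs_nonneg _) (Finset.mem_univ i)

lemma continuousOn_cov (hS : S.Regular) (t : ℕ) : ContinuousOn (S.cov t) S.cube := by
  obtain ⟨K, hK⟩ := hS.cov_lipschitz
  exact continuousOn_pi.2 fun i => continuousOn_pi.2 fun j =>
    continuousOn_of_abs_sub_le_l1 (K := K) fun x hx x' hx' => hK t x hx x' hx' i j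

/-- The Gaussian density of the observation at the projection of the state onto the cube. -/
def System.obsPdf (S : System M N) (t : ℕ) (x : Fin M → ℝ) (v : Fin N → ℝ) : ℝ :=
  gaussPdf (S.mean t (S.clamp x)) (S.obsCov t (S.clamp x)) v

/-- The means and covariances are controlled on the cube only; composing with the clamp gives a
density that is jointly continuous everywhere, hence measurable in state and observation. The
inverse covariance is the adjugate over a determinant that is at least `1`. -/
lemma System.continuous_obsPdf (hS : S.Regular) (t : ℕ) :
    Continuous fun p : (Fin M → ℝ) × (Fin N → ℝ) => S.obsPdf t p.1 p.2 := by
  have hm : Continuous fun x => S.mean t (S.clamp x) :=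
    (continuousOn_mean hS t).comp_continuous S.continuous_clamp (System.clamp_mem hS.lt)
  have hC : Continuous fun x => S.obsCov t (S.clamp x) :=
    ((continuousOn_cov hS t).comp_continuous S.continuous_clamp
      (System.clamp_mem hS.lt)).add continuous_const
  have hd : ∀ x, 0 < (S.obsCov t (S.clamp x)).det := fun x =>
    zero_lt_one.trans_le (one_le_det_obsCov hS t (System.clamp_mem hS.lt x))
  have hinv : Continuous fun x => (S.obsCov t (S.clamp x))⁻¹ := by
    simp only [Matrix.inv_def, Ring.inverse_eq_inv']
    exact (hC.matrix_det.inv₀ fun x => (hd x).ne').smul hC.matrix_adjugate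
  have hm' := hm.comp (continuous_fst (X := Fin M → ℝ) (Y := Fin N → ℝ))
  have hinv' := hinv.comp (continuous_fst (X := Fin M → ℝ) (Y := Fin N → ℝ))
  have hC' := hC.comp (continuous_fst (X := Fin M → ℝ) (Y := Fin N → ℝ))
  have hv : Continuous fun p : (Fin M → ℝ) × (Fin N → ℝ) => p.2 - S.mean t (S.clamp p.1) :=
    continuous_snd.sub hm'
  unfold System.obsPdf gaussPdf
  refine Continuous.mul (Continuous.inv₀ ?_ ?_) (Real.continuous_exp.comp ?_)
  · exact (continuous_const.mul hC'.matrix_det).sqrt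
  · intro p
    have := hd p.1
    positivity
  · exact continuous_const.mul (hv.dotProduct (hinv'.matrix_mulVec hv))

lemma System.obsPdf_of_mem {x : Fin M → ℝ} (hx : x ∈ S.cube) (t : ℕ) (v : Fin N → ℝ) :
    S.obsPdf t x v = gaussPdf (S.mean t x) (S.obsCov t x) v := by
  rw [System.obsPdf, System.clamp_of_mem hx]

lemma System.obsPdf_pos (hS : S.Regular) (t : ℕ) (x : Fin M → ℝ) (v : Fin N → ℝ) :
    0 < S.obsPdf t x v :=
  gaussPdf_pos (zero_lt_one.trans_le (one_le_det_obsCov hS t (System.clamp_mem hS.lt x))) _ _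

lemma System.obsPdf_le (hS : S.Regular) (t : ℕ) (x : Fin M → ℝ) (v : Fin N → ℝ) :
    S.obsPdf t x v ≤ ((√(2 * Real.pi)) ^ N)⁻¹ :=
  gaussPdf_le (obsCov_posDef hS t (System.clamp_mem hS.lt x))
    (one_le_det_obsCov hS t (System.clamp_mem hS.lt x)) _ _

lemma System.lik_of_mem {x : Fin M → ℝ} (hx : x ∈ S.cube) (t : ℕ) (v : Fin N → ℝ) :
    S.lik t x v = (√(2 * Real.pi)) ^ N * S.obsPdf t x v := by
  rw [System.lik, System.obsPdf_of_mem hx]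

lemma System.lik_pos (hS : S.Regular) (t : ℕ) {x : Fin M → ℝ} (hx : x ∈ S.cube)
    (v : Fin N → ℝ) : 0 < S.lik t x v := by
  rw [System.lik_of_mem hx]
  exact mul_pos (by positivity) (System.obsPdf_pos hS t x v)

/-- This bound makes the update with an observation mass-decreasing, for the exact filter and for
the grid filter alike. -/
lemma System.lik_le_one (hS : S.Regular) (t : ℕ) {x : Fin M → ℝ} (hx : x ∈ S.cube)
    (v : Fin N → ℝ) : S.lik t x v ≤ 1 := by
  rw [System.lik_of_mem hx]
  have h : 0 < (√(2 * Real.pi)) ^ N := by positivity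
  calc _ ≤ _ := mul_le_mul_of_nonneg_left (System.obsPdf_le hS t x v) h.le
    _ = 1 := mul_inv_cancel₀ h.ne'

lemma System.measurable_lik (S : System M N) (t : ℕ) (x : Fin M → ℝ) : Measurable (S.lik t x) :=
  (measurable_gaussPdf _ _).const_mul _

end likelihood

/-! ### Stationarity, and the transition matrix of the quantized state -/

section stationary

variable {S : System M N} {P : Measure Ω} {X : ℕ → Ω → (Fin M → ℝ)} {y : ℕ → Ω → (Fin N → ℝ)}

lemma measure_state_inter (h : IsRealization S P X y) (t : ℕ) {A B : Set (Fin M → ℝ)}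
    (hA : MeasurableSet A) (hB : MeasurableSet B) :
    P (X t ⁻¹' B ∩ X (t + 1) ⁻¹' A) = ∫⁻ x in B, S.kernel x A ∂(P.map (X t)) := by
  have hG : MeasurableSet[history X t] (X t ⁻¹' B) :=
    (le_iSup₂_of_le (f := fun s (_ : s ≤ t) => MeasurableSpace.comap (X s) inferInstance)
      t le_rfl le_rfl) _ ⟨B, hB, rfl⟩
  rw [h.markov_property t A _ hA hG,
    setLIntegral_map hB (S.kernel.measurable_coe hA) (h.measurable_state t)]

/-- With `B` the whole space, the Markov property says that the law of `X (t + 1)` is the law of `X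
t` pushed through the kernel; invariance closes the induction. -/
lemma map_state (h : IsRealization S P X y) (t : ℕ) : P.map (X t) = P.map (X 0) := by
  induction t with
  | zero => rfl
  | succ t ih =>
    ext A hA
    have h1 := measure_state_inter h t hA MeasurableSet.univ
    rw [Set.preimage_univ, Set.univ_inter, Measure.restrict_univ, ih] at h1
    rw [Measure.map_apply (h.measurable_state _) hA, h1,
      ← Measure.bind_apply hA S.kernel.aemeasurable, h.invariant.def]

lemma ae_mem_cube (h : IsRealization S P X y) : ∀ᵐ x ∂(P.map (X 0)), x ∈ S.cube :=
  (ae_map_iff (h.measurable_state 0).aemeasurable (measurableSet_cube S)).2 (h.mem_cube 0)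

/-- The time enters only through the law of `X t`, which is constant. For a null condition both
sides are `0`, by the conventions for inverse and division. -/
lemma cond_state_real [IsFiniteMeasure P] (hS : S.Regular) (h : IsRealization S P X y) (t : ℕ)
    {A B : Set (Fin M → ℝ)} (hA : MeasurableSet A) (hB : MeasurableSet B) :
    (ProbabilityTheory.cond P (X t ⁻¹' B)).real (X (t + 1) ⁻¹' A) =
      cumKernel S.kernel (P.map (X 0)) A B := by
  have := hS.markov
  rw [Measure.real, cond_apply (h.measurable_state t hB), measure_state_inter h t hA hB,
    ← Measure.map_apply (h.measurable_state t) hB, map_state h t, ENNReal.toReal_mul,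
    ENNReal.toReal_inv, cumKernel, div_eq_inv_mul]
  congr 1
  simp only [Measure.real]
  rw [integral_toReal (S.kernel.measurable_coe hA).aemeasurable
    (ae_of_all _ fun x => measure_lt_top _ _)]

lemma marginal_ae_eq (hS : S.Regular) (h : IsRealization S P X y) {L : ℕ} (hL : 1 ≤ L) (t : ℕ)
    (j : Idx M L) : {ω | marginal S L X t ω = S.center L j} =ᵐ[P] X t ⁻¹' S.cell L j := by
  filter_upwards [h.mem_cube t] with ω hω
  exact propext (quantize_eq_center_iff hS.lt hL hω)

lemma cond_marginal_real [IsFiniteMeasure P] (hS : S.Regular) (h : IsRealization S P X y) {L : ℕ}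
    (hL : 1 ≤ L) (t : ℕ) (i j : Idx M L) :
    (ProbabilityTheory.cond P {ω | marginal S L X t ω = S.center L j}).real
      {ω | marginal S L X (t + 1) ω = S.center L i} =
        cumKernel S.kernel (P.map (X 0)) (S.cell L i) (S.cell L j) := by
  rw [← cond_state_real hS h t (measurableSet_cell S L i) (measurableSet_cell S L j)]
  have h1 : ProbabilityTheory.cond P {ω | marginal S L X t ω = S.center L j} =
      ProbabilityTheory.cond P (X t ⁻¹' S.cell L j) := by
    rw [ProbabilityTheory.cond, ProbabilityTheory.cond, measure_congr (marginal_ae_eq hS h hL t j),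
      Measure.restrict_congr_set (marginal_ae_eq hS h hL t j)]
  rw [h1]
  exact measureReal_congr
    (ProbabilityTheory.cond_absolutelyContinuous.ae_le (marginal_ae_eq hS h hL (t + 1) i))

lemma transMatrix_apply [IsFiniteMeasure P] (hS : S.Regular) (h : IsRealization S P X y) {L : ℕ}
    (hL : 1 ≤ L) (i j : Idx M L) : transMatrix S P X L i j =
      cumKernel S.kernel (P.map (X 0)) (S.cell L i) (S.cell L j) :=
  cond_marginal_real hS h hL 0 i j

lemma initVec_apply (hS : S.Regular) (h : IsRealization S P X y) {L : ℕ} (hL : 1 ≤ L)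
    (j : Idx M L) : initVec S P X L j = (P.map (X 0)).real (S.cell L j) := by
  rw [initVec, measureReal_congr (marginal_ae_eq hS h hL 0 j),
    map_measureReal_apply (h.measurable_state 0) (measurableSet_cell S L j)]

end stationary

/-! ### Cumulative kernels -/

section cumKernel

variable {K : Kernel (Fin M → ℝ) (Fin M → ℝ)} {ν : Measure (Fin M → ℝ)}

lemma cumKernel_nonneg (A B : Set (Fin M → ℝ)) : 0 ≤ cumKernel K ν A B :=
  div_nonneg (integral_nonneg fun _ => measureReal_nonneg) measureReal_nonneg

lemma integrable_kernel_real [IsMarkovKernel K] [IsFiniteMeasure ν] {A : Set (Fin M → ℝ)} (hA : MeasurableSet A) :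
    Integrable (fun x => (K x).real A) ν :=
  .of_bound (K.measurable_coe hA).ennreal_toReal.aestronglyMeasurable 1
    (ae_of_all _ fun x => by
      rw [Real.norm_of_nonneg measureReal_nonneg]; exact measureReal_le_one)

/-- By invariance `∫ K(A|x) dν = ν(A) = 0`, so `K(A|x)` vanishes almost everywhere. Null cells are
thus never entered. -/
lemma cumKernel_eq_zero [IsFiniteMeasure ν] (hK : K.Invariant ν) {A B : Set (Fin M → ℝ)}
    (hA : MeasurableSet A) (h : ν.real A = 0) : cumKernel K ν A B = 0 := by
  have h1 : ∫⁻ x, K x A ∂ν = 0 := by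
    rw [← Measure.bind_apply hA K.aemeasurable, hK.def]
    exact (measureReal_eq_zero_iff).1 h
  rw [lintegral_eq_zero_iff (K.measurable_coe hA)] at h1
  have h2 : ∫ θ in B, (K θ).real A ∂ν = 0 := by
    rw [integral_eq_zero_of_ae]
    filter_upwards [ae_restrict_of_ae h1] with x hx
    simpa [Measure.real] using congrArg ENNReal.toReal hx
  rw [cumKernel, h2, zero_div]

variable {S : System M N} {L : ℕ}

lemma ae_kernel_cube [IsMarkovKernel K] (hK : K.Invariant ν) (hν : ∀ᵐ x ∂ν, x ∈ S.cube) :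
    ∀ᵐ x ∂ν, K x S.cube = 1 := by
  have h1 : ∫⁻ x, K x S.cubeᶜ ∂ν = 0 := by
    rw [← Measure.bind_apply (measurableSet_cube S).compl K.aemeasurable, hK.def]
    exact hν
  rw [lintegral_eq_zero_iff (K.measurable_coe (measurableSet_cube S).compl)] at h1
  filter_upwards [h1] with x hx
  exact (prob_compl_eq_zero_iff (measurableSet_cube S)).1 hx

lemma sum_cumKernel [IsMarkovKernel K] [IsFiniteMeasure ν] (hab : S.a < S.b) (hL : 1 ≤ L) (hK : K.Invariant ν)
    (hν : ∀ᵐ x ∂ν, x ∈ S.cube) (j : Idx M L) (hj : ν.real (S.cell L j) ≠ 0) :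
    ∑ i : Idx M L, cumKernel K ν (S.cell L i) (S.cell L j) = 1 := by
  simp only [cumKernel]
  rw [← Finset.sum_div, ← integral_finsetSum _ fun i _ =>
    (integrable_kernel_real (measurableSet_cell S L i)).integrableOn]
  have h1 : ∫ θ in S.cell L j, ∑ i : Idx M L, (K θ).real (S.cell L i) ∂ν =
      ∫ θ in S.cell L j, 1 ∂ν := by
    refine integral_congr_ae (ae_restrict_of_ae ?_)
    filter_upwards [ae_kernel_cube hK hν] with x hx
    rw [sum_measureReal_cell hab hL _ (by simp [hx]), Measure.real, hx, ENNReal.toReal_one]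
  rw [h1]
  simp [hj]

lemma sum_cumKernel_le [IsMarkovKernel K] [IsFiniteMeasure ν] (hab : S.a < S.b) (hL : 1 ≤ L) (hK : K.Invariant ν)
    (hν : ∀ᵐ x ∂ν, x ∈ S.cube) (j : Idx M L) :
    ∑ i : Idx M L, cumKernel K ν (S.cell L i) (S.cell L j) ≤ 1 := by
  -- The column of a null cell is zero by division by zero, so only the inequality holds for every
  -- column.
  by_cases hj : ν.real (S.cell L j) = 0
  · simp [cumKernel, hj]
  · exact (sum_cumKernel hab hL hK hν j hj).le

end cumKernel

/-! ### The consequence of conditional regularity -/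

/-- The kernel and its cumulative version on the cells of the grid differ, in total variation on
the grid, by a function whose integral tends to zero. -/
def System.GridRegular (S : System M N) (ν : Measure (Fin M → ℝ)) : Prop :=
  ∃ d : ℕ → (Fin M → ℝ) → ℝ, (∀ n, Integrable (d n) ν) ∧
    Tendsto (fun n => ∫ x, d n x ∂ν) atTop (𝓝 0) ∧
    ∀ L : ℕ, 1 ≤ L → ∀ᵐ x ∂ν, ∀ j : Idx M L, x ∈ S.cell L j →
      ∑ i : Idx M L, |(S.kernel x).real (S.cell L i)
        - cumKernel S.kernel ν (S.cell L i) (S.cell L j)| ≤ d L x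

/-- Vitali's theorem: uniform integrability upgrades almost everywhere convergence to convergence in
`L¹`. -/
lemma tendsto_integral_of_uniformIntegrable {α : Type*} [MeasurableSpace α] {ν : Measure α}
    [IsFiniteMeasure ν] {δ : ℕ → α → ℝ} (hδ : UniformIntegrable δ 1 ν)
    (h : ∀ᵐ x ∂ν, Tendsto (fun n => δ n x) atTop (𝓝 0)) :
    (∀ n, Integrable (δ n) ν) ∧ Tendsto (fun n => ∫ x, δ n x ∂ν) atTop (𝓝 0) := by
  have hi : ∀ n, Integrable (δ n) ν := fun n => memLp_one_iff_integrable.1 (hδ.memLp n)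
  refine ⟨hi, ?_⟩
  have h1 := tendsto_Lp_finite_of_tendsto_ae (g := fun _ => (0 : ℝ)) le_rfl ENNReal.one_ne_top
    hδ.1 MemLp.zero' hδ.unifIntegrable h
  simpa using tendsto_integral_of_L1' (f := fun _ => (0 : ℝ)) aestronglyMeasurable_const
    (.of_forall hi) h1

/-- There are `L ^ M` cells, each contributing at most `δ / L ^ M`. The condition `M ≠ 0` makes `L ^
M` tend to infinity. -/
lemma IsCRT1.gridRegular {S : System M N} {ν : Measure (Fin M → ℝ)} [IsFiniteMeasure ν]
    (h : IsCRT1 S ν) (hM : M ≠ 0) : S.GridRegular ν := by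
  obtain ⟨δ, -, hui, hlim, hδ⟩ := h
  obtain ⟨hi, ht⟩ := tendsto_integral_of_uniformIntegrable hui hlim
  refine ⟨fun L => δ (L ^ M), fun L => hi _, ht.comp (tendsto_pow_atTop hM), fun L hL => ?_⟩
  filter_upwards [hδ L hL] with x hx j hj
  refine (Finset.sum_le_sum fun i _ => hx j hj i).trans_eq ?_
  have : (L : ℝ) ^ M ≠ 0 := by positivity
  simp
  field_simp

/-- Fubini's theorem; `κ` is integrable on the product because its inner integral over `A` is
`K(A|x) ≤ 1`. -/
lemma cumKernel_density {K : Kernel (Fin M → ℝ) (Fin M → ℝ)} [IsMarkovKernel K]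
    {ν : Measure (Fin M → ℝ)} [IsFiniteMeasure ν] {κ : (Fin M → ℝ) → (Fin M → ℝ) → ℝ}
    (hκ : Measurable (Function.uncurry κ)) (h0 : ∀ y x, 0 ≤ κ y x)
    (hK : ∀ᵐ x ∂ν, K x = volume.withDensity fun y => ENNReal.ofReal (κ y x))
    {A : Set (Fin M → ℝ)} (hA : MeasurableSet A) (B : Set (Fin M → ℝ)) :
    IntegrableOn (fun y => cumDensity κ ν y B) A ∧
      ∫ y in A, cumDensity κ ν y B = cumKernel K ν A B := by
  have hm : Measurable (fun p : (Fin M → ℝ) × (Fin M → ℝ) => κ p.2 p.1) :=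
    hκ.comp measurable_swap
  have hint : Integrable (fun p : (Fin M → ℝ) × (Fin M → ℝ) => κ p.2 p.1)
      ((ν.restrict B).prod (volume.restrict A)) := by
    refine ⟨hm.aestronglyMeasurable, ?_⟩
    rw [hasFiniteIntegral_iff_ofReal (ae_of_all _ fun p => h0 _ _),
      lintegral_prod _ hm.ennreal_ofReal.aemeasurable]
    calc _ = ∫⁻ x in B, K x A ∂ν := by
          refine lintegral_congr_ae (ae_restrict_of_ae ?_)
          filter_upwards [hK] with x hx
          rw [hx, withDensity_apply _ hA]
      _ ≤ ∫⁻ x in B, 1 ∂ν := lintegral_mono fun x => prob_le_one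
      _ < ∞ := by simp
  refine ⟨hint.integral_prod_right.div_const _, ?_⟩
  unfold cumDensity cumKernel
  rw [integral_div]
  congr 1
  rw [← integral_integral_swap hint]
  refine integral_congr_ae (ae_restrict_of_ae ?_)
  filter_upwards [hK] with x hx
  rw [Measure.real, hx, withDensity_apply _ hA, integral_eq_lintegral_of_nonneg_ae
    (ae_of_all _ fun y => h0 y x)
    (hm.comp measurable_prodMk_left).aestronglyMeasurable]

/-- Integrating the density error over each cell and summing gives `δ` times the volume of the cube,
which is finite. -/
lemma IsCRT2.gridRegular {S : System M N} {ν : Measure (Fin M → ℝ)} [IsFiniteMeasure ν]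
    (h : IsCRT2 S ν) (hS : S.Regular) (hM : M ≠ 0) : S.GridRegular ν := by
  have := hS.markov
  obtain ⟨κ, hκ, h0, hK, δ, hδ0, hui, hlim, hδ⟩ := h
  obtain ⟨hi, ht⟩ := tendsto_integral_of_uniformIntegrable hui hlim
  have hvol : (volume : Measure (Fin M → ℝ)) S.cube ≠ ∞ := (isCompact_cube S).measure_lt_top.ne
  refine ⟨fun L x => δ (L ^ M) x * volume.real S.cube, fun L => (hi _).mul_const _, ?_,
    fun L hL => ?_⟩
  · simp only [integral_mul_const]
    simpa using (ht.comp (tendsto_pow_atTop hM)).mul_const (volume.real S.cube)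
  filter_upwards [hδ L hL, hK] with x hx hKx j hj
  rw [← sum_measureReal_cell hS.lt hL _ hvol, Finset.mul_sum]
  refine Finset.sum_le_sum fun i _ => ?_
  have hA := measurableSet_cell S L i
  have hκx : Measurable fun y => κ y x := hκ.comp measurable_prodMk_right
  have hi1 : IntegrableOn (fun y => κ y x) (S.cell L i) := by
    refine ⟨hκx.aestronglyMeasurable, ?_⟩
    rw [hasFiniteIntegral_iff_ofReal (ae_of_all _ fun y => h0 _ _), ← withDensity_apply _ hA,
      ← hKx]
    exact measure_lt_top _ _
  have h1 : (S.kernel x).real (S.cell L i) = ∫ y in S.cell L i, κ y x := by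
    rw [Measure.real, hKx, withDensity_apply _ hA, integral_eq_lintegral_of_nonneg_ae
      (ae_of_all _ fun y => h0 y x) hκx.aestronglyMeasurable]
  obtain ⟨hi2, h2⟩ := cumKernel_density hκ h0 hK hA (S.cell L j)
  rw [h1, ← h2, ← integral_sub hi1 hi2, ← Real.norm_eq_abs]
  refine norm_setIntegral_le_of_norm_le_const_ae
    (lt_of_le_of_lt (measure_mono (cell_subset_cube hS.lt i)) hvol.lt_top) ?_
  filter_upwards [ae_restrict_of_ae (hx j hj)] with y hy
  exact hy

/-! ### Convergence of the grid recursion for fixed observations -/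

lemma bind_mono_left {K : Kernel (Fin M → ℝ) (Fin M → ℝ)} {μ ν : Measure (Fin M → ℝ)}
    (h : μ ≤ ν) : μ.bind K ≤ ν.bind K := by
  refine Measure.le_iff.2 fun A hA => ?_
  rw [Measure.bind_apply hA K.aemeasurable, Measure.bind_apply hA K.aemeasurable]
  exact lintegral_mono' h le_rfl

lemma withDensity_ofReal_le_self {α : Type*} [MeasurableSpace α] (μ : Measure α) {f : α → ℝ}
    (hf : ∀ x, f x ≤ 1) : μ.withDensity (fun x => ENNReal.ofReal (f x)) ≤ μ := by
  conv_rhs => rw [← withDensity_one (μ := μ)]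
  exact withDensity_mono (ae_of_all _ fun x => by simpa using hf x)

lemma withDensity_ofReal_real {α : Type*} [MeasurableSpace α] (μ : Measure α) {f : α → ℝ}
    (hf : Measurable f) (h0 : ∀ x, 0 ≤ f x) {A : Set α} (hA : MeasurableSet A) :
    (μ.withDensity fun x => ENNReal.ofReal (f x)).real A = ∫ x in A, f x ∂μ := by
  rw [Measure.real, withDensity_apply _ hA,
    integral_eq_lintegral_of_nonneg_ae (ae_of_all _ h0) hf.aestronglyMeasurable]

/-- The unnormalized optimal filter, as a measure on the state space, for the likelihoods `ℓ`. -/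
def unnormFilter (K : Kernel (Fin M → ℝ) (Fin M → ℝ)) (ν : Measure (Fin M → ℝ))
    (ℓ : ℕ → (Fin M → ℝ) → ℝ) : ℕ → Measure (Fin M → ℝ)
  | 0 => ν
  | t + 1 => ((unnormFilter K ν ℓ t).bind K).withDensity fun x => ENNReal.ofReal (ℓ t x)

/-- The unnormalized grid filter for the likelihoods `ℓ`. -/
def System.gridVec (S : System M N) (ν : Measure (Fin M → ℝ)) (L : ℕ)
    (ℓ : ℕ → (Fin M → ℝ) → ℝ) : ℕ → Idx M L → ℝ
  | 0 => fun j => ν.real (S.cell L j)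
  | t + 1 => fun i => ℓ t (S.center L i) *
      ∑ j, cumKernel S.kernel ν (S.cell L i) (S.cell L j) * S.gridVec ν L ℓ t j

section deterministic

variable {S : System M N} {ν : Measure (Fin M → ℝ)}

/-- The kernel step keeps a measure below `ν = νK`, and the factor `ℓ ≤ 1` only decreases it.
Through this domination, errors that are small under `ν` are small under every filter. -/
lemma unnormFilter_le (hK : S.kernel.Invariant ν) {ℓ : ℕ → (Fin M → ℝ) → ℝ}
    (h1 : ∀ t x, ℓ t x ≤ 1) (t : ℕ) : unnormFilter S.kernel ν ℓ t ≤ ν := by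
  induction t with
  | zero => exact le_rfl
  | succ t ih =>
    exact (withDensity_ofReal_le_self _ (h1 t)).trans ((bind_mono_left ih).trans_eq hK.def)

/-- A Markov kernel preserves total mass and a positive density does not annihilate it; this makes
the normalizing constant nonzero. -/
lemma unnormFilter_ne_zero [IsMarkovKernel S.kernel] (hν : ν ≠ 0) {ℓ : ℕ → (Fin M → ℝ) → ℝ}
    (hm : ∀ t, Measurable (ℓ t)) (h0 : ∀ t x, 0 < ℓ t x) (t : ℕ) :
    unnormFilter S.kernel ν ℓ t ≠ 0 := by
  induction t with
  | zero => exact hν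
  | succ t ih =>
    intro h
    rw [unnormFilter, withDensity_eq_zero_iff (hm t).ennreal_ofReal.aemeasurable] at h
    refine ih ?_
    rw [← Measure.measure_univ_eq_zero]
    have h2 : ((unnormFilter S.kernel ν ℓ t).bind S.kernel) Set.univ = 0 := by
      refine measure_mono_null (fun x _ => ?_) h
      simpa using h0 t x
    rwa [Measure.bind_apply MeasurableSet.univ S.kernel.aemeasurable,
      lintegral_congr (g := fun _ => 1) fun x => measure_univ, lintegral_one] at h2

/-- On the cell `j` the difference is the `μ`-integral of `K(𝒵^i|x) - K(𝒵^i|∈𝒵^j)`. Summing over `i`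
under the integral produces the bound `d`, and `μ ≤ ν` permits replacing `μ` by `ν`. -/
lemma sum_abs_kernel_sub_le [IsMarkovKernel S.kernel] [IsFiniteMeasure ν] (hS : S.Regular)
    (hν : ∀ᵐ x ∂ν, x ∈ S.cube) {L : ℕ} (hL : 1 ≤ L)
    {d : (Fin M → ℝ) → ℝ} (hdi : Integrable d ν)
    (hd : ∀ᵐ x ∂ν, ∀ j : Idx M L, x ∈ S.cell L j → ∑ i : Idx M L,
      |(S.kernel x).real (S.cell L i) - cumKernel S.kernel ν (S.cell L i) (S.cell L j)| ≤ d x)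
    {μ : Measure (Fin M → ℝ)} [IsFiniteMeasure μ] (hμ : μ ≤ ν) :
    ∑ i : Idx M L, |(∫ x, (S.kernel x).real (S.cell L i) ∂μ) -
      ∑ j, cumKernel S.kernel ν (S.cell L i) (S.cell L j) * μ.real (S.cell L j)| ≤
        ∫ x, d x ∂ν := by
  have hμν : μ ≪ ν := Measure.absolutelyContinuous_of_le hμ
  have hint : ∀ i : Idx M L, Integrable (fun x => (S.kernel x).real (S.cell L i)) μ := fun i =>
    integrable_kernel_real (measurableSet_cell S L i)
  have hint' : ∀ i j : Idx M L, Integrable (fun x => |(S.kernel x).real (S.cell L i) -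
      cumKernel S.kernel ν (S.cell L i) (S.cell L j)|) (μ.restrict (S.cell L j)) := fun i j =>
    ((hint i).integrableOn.sub (integrable_const _)).abs
  -- Enlarging the measure needs `d ≥ 0`, which holds on the cells because `d` bounds a sum of
  -- absolute values there.
  have hdabs : ∀ᵐ x ∂ν, ∀ j : Idx M L, x ∈ S.cell L j → 0 ≤ d x := by
    filter_upwards [hd] with x hx j hj
    exact (Finset.sum_nonneg fun _ _ => abs_nonneg _).trans (hx j hj)
  calc _ ≤ ∑ i : Idx M L, ∑ j : Idx M L, ∫ x in S.cell L j, |(S.kernel x).real (S.cell L i) -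
          cumKernel S.kernel ν (S.cell L i) (S.cell L j)| ∂μ := by
        refine Finset.sum_le_sum fun i _ => ?_
        rw [← sum_setIntegral_cell hS.lt hL (hμν.ae_le hν) (hint i), ← Finset.sum_sub_distrib]
        refine (Finset.abs_sum_le_sum_abs _ _).trans (Finset.sum_le_sum fun j _ => ?_)
        have : cumKernel S.kernel ν (S.cell L i) (S.cell L j) * μ.real (S.cell L j) =
            ∫ _x in S.cell L j, cumKernel S.kernel ν (S.cell L i) (S.cell L j) ∂μ := by
          rw [setIntegral_const, smul_eq_mul, mul_comm]
        rw [this, ← integral_sub (hint i).integrableOn (integrable_const _)]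
        exact abs_integral_le_integral_abs
    _ = ∑ j : Idx M L, ∫ x in S.cell L j, ∑ i : Idx M L, |(S.kernel x).real (S.cell L i) -
          cumKernel S.kernel ν (S.cell L i) (S.cell L j)| ∂μ := by
        rw [Finset.sum_comm]
        exact Finset.sum_congr rfl fun j _ => (integral_finsetSum _ fun i _ => hint' i j).symm
    _ ≤ ∑ j : Idx M L, ∫ x in S.cell L j, d x ∂ν := by
        refine Finset.sum_le_sum fun j _ => ?_
        have h1 : ∀ᵐ x ∂(ν.restrict (S.cell L j)), x ∈ S.cell L j :=
          ae_restrict_mem (measurableSet_cell S L j)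
        have hle := Measure.restrict_mono (μ := μ) (ν := ν) subset_rfl hμ (s := S.cell L j)
        refine (integral_mono_ae (g := d) (integrable_finsetSum _ fun i _ => hint' i j)
          (hdi.integrableOn.mono_measure hμ) ?_).trans
          (integral_mono_measure hle ?_ hdi.integrableOn)
        · refine (Measure.absolutelyContinuous_of_le hle).ae_le ?_
          filter_upwards [h1, ae_restrict_of_ae hd] with x hx hx'
          exact hx' j hx
        · filter_upwards [h1, ae_restrict_of_ae hdabs] with x hx hx'
          exact hx' j hx
    _ = _ := sum_setIntegral_cell hS.lt hL hν hdi

/-- The intermediate quantity is `f(x^i) (μK)(𝒵^i)`. Reaching it from the exact update costs the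
oscillation of `f`; reaching it from the grid update costs the previous error plus the kernel error.
-/
lemma grid_step_error [IsMarkovKernel S.kernel] [IsFiniteMeasure ν] (hS : S.Regular)
    (hK : S.kernel.Invariant ν) (hν : ∀ᵐ x ∂ν, x ∈ S.cube) {L : ℕ} (hL : 1 ≤ L)
    {d : (Fin M → ℝ) → ℝ} (hdi : Integrable d ν)
    (hd : ∀ᵐ x ∂ν, ∀ j : Idx M L, x ∈ S.cell L j → ∑ i : Idx M L,
      |(S.kernel x).real (S.cell L i) - cumKernel S.kernel ν (S.cell L i) (S.cell L j)| ≤ d x)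
    {μ : Measure (Fin M → ℝ)} [IsFiniteMeasure μ] (hμ : μ ≤ ν) {f : (Fin M → ℝ) → ℝ}
    (hf : Measurable f) (h0 : ∀ x, 0 ≤ f x) (h1 : ∀ x, f x ≤ 1) {ε : ℝ}
    (hosc : ∀ i : Idx M L, ∀ x ∈ S.cell L i, |f x - f (S.center L i)| ≤ ε) (e : Idx M L → ℝ) :
    ∑ i : Idx M L, |f (S.center L i) *
        (∑ j, cumKernel S.kernel ν (S.cell L i) (S.cell L j) * e j) -
        ((μ.bind S.kernel).withDensity fun x => ENNReal.ofReal (f x)).real (S.cell L i)| ≤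
      ε * ν.real S.cube + ∑ j, |e j - μ.real (S.cell L j)| + ∫ x, d x ∂ν := by
  have hbind : μ.bind S.kernel ≤ ν := (bind_mono_left hμ).trans_eq hK.def
  have : IsFiniteMeasure (μ.bind S.kernel) := isFiniteMeasure_of_le _ hbind
  have hfi : Integrable f (μ.bind S.kernel) :=
    .of_bound hf.aestronglyMeasurable 1 (ae_of_all _ fun x => by
      rw [Real.norm_of_nonneg (h0 x)]; exact h1 x)
  set p : Idx M L → Idx M L → ℝ := fun i j =>
    cumKernel S.kernel ν (S.cell L i) (S.cell L j) with hp
  set A : Idx M L → ℝ := fun i => (μ.bind S.kernel).real (S.cell L i) with hA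
  have hAint : ∀ i, A i = ∫ x, (S.kernel x).real (S.cell L i) ∂μ := by
    intro i
    simp only [hA, Measure.real]
    rw [Measure.bind_apply (measurableSet_cell S L i) S.kernel.aemeasurable,
      integral_toReal (S.kernel.measurable_coe (measurableSet_cell S L i)).aemeasurable
        (ae_of_all _ fun x => measure_lt_top _ _)]
  have hstep1 : ∀ i, |f (S.center L i) * A i -
      ((μ.bind S.kernel).withDensity fun x => ENNReal.ofReal (f x)).real (S.cell L i)| ≤
        ε * A i := by
    intro i
    rw [withDensity_ofReal_real _ hf h0 (measurableSet_cell S L i), abs_sub_comm]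
    have h2 : f (S.center L i) * A i = ∫ _x in S.cell L i, f (S.center L i) ∂μ.bind S.kernel := by
      rw [setIntegral_const, smul_eq_mul, mul_comm]
    rw [h2, ← integral_sub hfi.integrableOn (integrable_const _), ← Real.norm_eq_abs]
    exact norm_setIntegral_le_of_norm_le_const (measure_lt_top _ _) fun x hx => hosc i x hx
  have hstep2 : ∀ i, |f (S.center L i) * (∑ j, p i j * e j) - f (S.center L i) * A i| ≤
      (∑ j, p i j * |e j - μ.real (S.cell L j)|) +
        |(∫ x, (S.kernel x).real (S.cell L i) ∂μ) - ∑ j, p i j * μ.real (S.cell L j)| := by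
    intro i
    rw [← mul_sub, abs_mul, abs_of_nonneg (h0 _)]
    refine (mul_le_of_le_one_left (abs_nonneg _) (h1 _)).trans ?_
    have h3 : (∑ j, p i j * e j) - A i = (∑ j, p i j * (e j - μ.real (S.cell L j))) -
        ((∫ x, (S.kernel x).real (S.cell L i) ∂μ) - ∑ j, p i j * μ.real (S.cell L j)) := by
      rw [hAint]
      simp only [mul_sub, Finset.sum_sub_distrib]
      ring
    rw [h3]
    refine (abs_sub _ _).trans (add_le_add_left ?_ _)
    refine (Finset.abs_sum_le_sum_abs _ _).trans_eq (Finset.sum_congr rfl fun j _ => ?_)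
    rw [abs_mul, abs_of_nonneg (cumKernel_nonneg _ _)]
  have hsumA : ∑ i, A i ≤ ν.real S.cube := by
    rw [sum_measureReal_cell hS.lt hL _ (measure_ne_top _ _)]
    exact ENNReal.toReal_mono (measure_ne_top _ _) (hbind _)
  -- A cell exists since the cube is nonempty; its oscillation bound forces `ε ≥ 0`.
  obtain ⟨i₀, -⟩ := exists_mem_cell (S := S) hS.lt hL (System.clamp_mem hS.lt 0)
  have hε : 0 ≤ ε := (abs_nonneg _).trans (hosc i₀ _ (center_mem_cell hS.lt i₀))
  calc _ ≤ ∑ i, (((∑ j, p i j * |e j - μ.real (S.cell L j)|) +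
        |(∫ x, (S.kernel x).real (S.cell L i) ∂μ) - ∑ j, p i j * μ.real (S.cell L j)|) +
          ε * A i) :=
        Finset.sum_le_sum fun i _ => (abs_sub_le _ (f (S.center L i) * A i) _).trans
          (add_le_add (hstep2 i) (hstep1 i))
    _ = (∑ j, (∑ i, p i j) * |e j - μ.real (S.cell L j)|) +
        (∑ i, |(∫ x, (S.kernel x).real (S.cell L i) ∂μ) - ∑ j, p i j * μ.real (S.cell L j)|) +
          ε * ∑ i, A i := by
        rw [Finset.sum_add_distrib, Finset.sum_add_distrib, Finset.mul_sum, Finset.sum_comm]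
        simp only [Finset.sum_mul]
    _ ≤ (∑ j, |e j - μ.real (S.cell L j)|) + (∫ x, d x ∂ν) + ε * ν.real S.cube := by
        refine add_le_add (add_le_add (Finset.sum_le_sum fun j _ => ?_)
          (sum_abs_kernel_sub_le hS hν hL hdi hd hμ)) (mul_le_mul_of_nonneg_left hsumA hε)
        exact mul_le_of_le_one_left (abs_nonneg _) (sum_cumKernel_le hS.lt hL hK hν j)
    _ = _ := by ring

lemma eventually_cell_oscillation_le (hS : S.Regular) {f : (Fin M → ℝ) → ℝ} (hf : Continuous f)
    {ε : ℝ} (hε : 0 < ε) : ∀ᶠ L : ℕ in atTop, ∀ i : Idx M L, ∀ x ∈ S.cell L i,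
      |f x - f (S.center L i)| ≤ ε := by
  have huc := (isCompact_cube S).uniformContinuousOn_of_continuous hf.continuousOn
  obtain ⟨r, hr, h⟩ := Metric.uniformContinuousOn_iff.1 huc ε hε
  have hlim : Tendsto (fun L : ℕ => (S.b - S.a) / L) atTop (𝓝 0) :=
    tendsto_const_div_atTop_nhds_zero_nat _
  filter_upwards [hlim.eventually (gt_mem_nhds hr)] with L hL i x hx
  have := h x (cell_subset_cube hS.lt i hx) _ (center_mem_cube hS.lt i)
    ((dist_center_le hS.lt hx).trans_lt hL)
  rw [Real.dist_eq] at this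
  exact this.le

lemma tendsto_gridVec_error [IsMarkovKernel S.kernel] [IsFiniteMeasure ν] (hS : S.Regular)
    (hK : S.kernel.Invariant ν) (hν : ∀ᵐ x ∂ν, x ∈ S.cube) (hreg : S.GridRegular ν)
    {ℓ : ℕ → (Fin M → ℝ) → ℝ} (hc : ∀ t, Continuous (ℓ t)) (h0 : ∀ t x, 0 < ℓ t x)
    (h1 : ∀ t x, ℓ t x ≤ 1) (t : ℕ) :
    Tendsto (fun L => ∑ j : Idx M L, |S.gridVec ν L ℓ t j -
      (unnormFilter S.kernel ν ℓ t).real (S.cell L j)|) atTop (𝓝 0) := by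
  induction t with
  | zero => simp [System.gridVec, unnormFilter]
  | succ t ih =>
    obtain ⟨d, hdi, hdlim, hd⟩ := hreg
    have hle := unnormFilter_le hK h1 t
    have : IsFiniteMeasure (unnormFilter S.kernel ν ℓ t) := isFiniteMeasure_of_le _ hle
    rw [Metric.tendsto_atTop']
    intro ε hε
    have hc0 : 0 ≤ ν.real S.cube := measureReal_nonneg
    -- The `+ 1` avoids a division by zero; the oscillation term stays below `ε / 2`.
    have hε' : 0 < ε / 2 / (ν.real S.cube + 1) := by positivity
    have h2 := (ih.add hdlim).eventually (gt_mem_nhds (show (0 : ℝ) + 0 < ε / 2 by linarith))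
    have h3 := (eventually_cell_oscillation_le hS (hc t) hε').and
      (h2.and (eventually_ge_atTop 1))
    obtain ⟨n, hn⟩ := eventually_atTop.1 h3
    refine ⟨n, fun L hL => ?_⟩
    obtain ⟨h4, h5, h6⟩ := hn L hL.le
    rw [Real.dist_eq, sub_zero, abs_of_nonneg (Finset.sum_nonneg fun _ _ => abs_nonneg _)]
    have h7 := grid_step_error hS hK hν h6 (hdi L) (hd L h6) hle (hc t).measurable
      (fun x => (h0 t x).le) (h1 t) h4 (S.gridVec ν L ℓ t)
    have h8 : ε / 2 / (ν.real S.cube + 1) * ν.real S.cube ≤ ε / 2 := by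
      rw [div_mul_eq_mul_div, div_le_iff₀ (by positivity)]
      nlinarith
    refine lt_of_le_of_lt h7 ?_
    linarith

lemma gridVec_nonneg {ℓ : ℕ → (Fin M → ℝ) → ℝ} {L : ℕ}
    (h0 : ∀ t (i : Idx M L), 0 < ℓ t (S.center L i)) (t : ℕ) (j : Idx M L) :
    0 ≤ S.gridVec ν L ℓ t j := by
  induction t generalizing j with
  | zero => exact measureReal_nonneg
  | succ t ih =>
    exact mul_nonneg (h0 t j).le
      (Finset.sum_nonneg fun i _ => mul_nonneg (cumKernel_nonneg _ _) (ih i))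

/-- Passing through `∑ g(x^j) μ(𝒵^j)` separates the error of the masses, weighted by `sup |g|`, from
the Riemann sum error. -/
lemma abs_sum_cell_sub_integral_le (hS : S.Regular) {L : ℕ} (hL : 1 ≤ L)
    {μ : Measure (Fin M → ℝ)} [IsFiniteMeasure μ] (hμ : ∀ᵐ x ∂μ, x ∈ S.cube)
    {g : (Fin M → ℝ) → ℝ} (hg : Continuous g) {B ε : ℝ} (hB : ∀ x ∈ S.cube, |g x| ≤ B)
    (hosc : ∀ i : Idx M L, ∀ x ∈ S.cell L i, |g x - g (S.center L i)| ≤ ε) (e : Idx M L → ℝ) :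
    |(∑ j, g (S.center L j) * e j) - ∫ x, g x ∂μ| ≤
      B * (∑ j, |e j - μ.real (S.cell L j)|) + ε * μ.real S.cube := by
  have hgi : Integrable g μ := .of_bound hg.aestronglyMeasurable B (by
    filter_upwards [hμ] with x hx using hB x hx)
  rw [← sum_setIntegral_cell hS.lt hL hμ hgi, ← Finset.sum_sub_distrib,
    ← sum_measureReal_cell hS.lt hL _ (measure_ne_top _ _), Finset.mul_sum, Finset.mul_sum,
    ← Finset.sum_add_distrib]
  refine (Finset.abs_sum_le_sum_abs _ _).trans (Finset.sum_le_sum fun j _ => ?_)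
  refine (abs_sub_le _ (g (S.center L j) * μ.real (S.cell L j)) _).trans (add_le_add ?_ ?_)
  · rw [← mul_sub, abs_mul]
    exact mul_le_mul_of_nonneg_right (hB _ (center_mem_cube hS.lt j)) (abs_nonneg _)
  · have h2 : g (S.center L j) * μ.real (S.cell L j) = ∫ _x in S.cell L j, g (S.center L j) ∂μ := by
      rw [setIntegral_const, smul_eq_mul, mul_comm]
    rw [abs_sub_comm, h2, ← integral_sub hgi.integrableOn (integrable_const _),
      ← Real.norm_eq_abs]
    exact norm_setIntegral_le_of_norm_le_const (measure_lt_top _ _) fun x hx => hosc j x hx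

lemma tendsto_sum_gridVec [IsMarkovKernel S.kernel] [IsFiniteMeasure ν] (hS : S.Regular)
    (hK : S.kernel.Invariant ν) (hν : ∀ᵐ x ∂ν, x ∈ S.cube) (hreg : S.GridRegular ν)
    {ℓ : ℕ → (Fin M → ℝ) → ℝ} (hc : ∀ t, Continuous (ℓ t)) (h0 : ∀ t x, 0 < ℓ t x)
    (h1 : ∀ t x, ℓ t x ≤ 1) (t : ℕ) {g : (Fin M → ℝ) → ℝ} (hg : Continuous g) :
    Tendsto (fun L => ∑ j : Idx M L, g (S.center L j) * S.gridVec ν L ℓ t j) atTop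
      (𝓝 (∫ x, g x ∂(unnormFilter S.kernel ν ℓ t))) := by
  have hle := unnormFilter_le hK h1 t
  have hfin : IsFiniteMeasure (unnormFilter S.kernel ν ℓ t) := isFiniteMeasure_of_le _ hle
  have hae := (Measure.absolutelyContinuous_of_le hle).ae_le hν
  obtain ⟨B, hB⟩ := (isCompact_cube S).exists_bound_of_continuousOn hg.continuousOn
  have herr := (tendsto_gridVec_error hS hK hν hreg hc h0 h1 t).const_mul B
  set μ := unnormFilter S.kernel ν ℓ t
  rw [mul_zero] at herr
  rw [Metric.tendsto_atTop']
  intro ε hε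
  have hc0 : 0 ≤ μ.real S.cube := measureReal_nonneg
  have hε' : 0 < ε / 2 / (μ.real S.cube + 1) := by positivity
  obtain ⟨n, hn⟩ := eventually_atTop.1 ((eventually_cell_oscillation_le hS hg hε').and
    ((herr.eventually (gt_mem_nhds (half_pos hε))).and (eventually_ge_atTop 1)))
  refine ⟨n, fun L hL => ?_⟩
  obtain ⟨h4, h5, h6⟩ := hn L hL.le
  rw [Real.dist_eq]
  have h7 := abs_sum_cell_sub_integral_le hS h6 hae hg hB h4 (S.gridVec ν L ℓ t)
  have h8 : ε / 2 / (μ.real S.cube + 1) * μ.real S.cube ≤ ε / 2 := by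
    rw [div_mul_eq_mul_div, div_le_iff₀ (by positivity)]
    nlinarith
  refine lt_of_le_of_lt h7 ?_
  linarith

end deterministic

/-! ### The unnormalized filter as an expectation over the state process -/

lemma integral_withDensity_ofReal {α : Type*} [MeasurableSpace α] {μ : Measure α} {f : α → ℝ}
    (hf : Measurable f) (h0 : ∀ x, 0 ≤ f x) (g : α → ℝ) :
    ∫ x, g x ∂(μ.withDensity fun x => ENNReal.ofReal (f x)) = ∫ x, f x * g x ∂μ := by
  rw [integral_withDensity_eq_integral_toReal_smul hf.ennreal_ofReal
    (ae_of_all _ fun x => ENNReal.ofReal_lt_top)]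
  exact integral_congr_ae (ae_of_all _ fun x => by
    simp only [ENNReal.toReal_ofReal (h0 x), smul_eq_mul])

lemma history_le {β : Type*} [MeasurableSpace β] {Z : ℕ → Ω → β} (hZ : ∀ t, Measurable (Z t))
    (t : ℕ) : history Z t ≤ ‹MeasurableSpace Ω› :=
  iSup₂_le fun s _ => (hZ s).comap_le

lemma measurable_history {Ω β : Type*} [MeasurableSpace β] (Z : ℕ → Ω → β) {s t : ℕ}
    (hst : s ≤ t) : Measurable[history Z t] (Z s) :=
  Measurable.mono (comap_measurable (Z s))
    (le_iSup₂_of_le (f := fun s (_ : s ≤ t) => MeasurableSpace.comap (Z s) inferInstance)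
      s hst le_rfl) le_rfl

section markov

variable {S : System M N} {P : Measure Ω} {X : ℕ → Ω → (Fin M → ℝ)} {y : ℕ → Ω → (Fin N → ℝ)}

/-- The Markov property says that two measures agree on the history of the state, so they give the
same integral to every history-measurable weight. -/
lemma lintegral_markov [IsFiniteMeasure P] (h : IsRealization S P X y) (t : ℕ)
    {A : Set (Fin M → ℝ)} (hA : MeasurableSet A) {W : Ω → ℝ≥0∞}
    (hW : Measurable[history X t] W) :
    ∫⁻ ω in X (t + 1) ⁻¹' A, W ω ∂P = ∫⁻ ω, W ω * S.kernel (X t ω) A ∂P := by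
  have hm := history_le h.measurable_state t
  have hk : Measurable fun ω => S.kernel (X t ω) A :=
    (S.kernel.measurable_coe hA).comp (h.measurable_state t)
  have heq : (P.restrict (X (t + 1) ⁻¹' A)).trim hm =
      (P.withDensity fun ω => S.kernel (X t ω) A).trim hm := by
    refine @Measure.ext _ (history X t) _ _ fun G hG => ?_
    rw [trim_measurableSet_eq hm hG, trim_measurableSet_eq hm hG,
      Measure.restrict_apply (hm _ hG), withDensity_apply _ (hm _ hG),
      h.markov_property t A G hA hG]
  rw [← lintegral_trim hm hW, heq, lintegral_trim hm hW,
    lintegral_withDensity_eq_lintegral_mul _ hk (hW.mono hm le_rfl)]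
  simp only [Pi.mul_apply, mul_comm]

/-- A Feynman–Kac representation: the recursion of measures is the law of the current state under
`P` reweighted by the past likelihoods. With the shifted time, the weight up to `t` uses the states
`1, …, t` and is known at time `t`, as `lintegral_markov` requires. -/
lemma unnormFilter_eq_map [IsFiniteMeasure P] (h : IsRealization S P X y)
    {ℓ : ℕ → (Fin M → ℝ) → ℝ} (hℓ : ∀ t, Measurable (ℓ t)) (h0 : ∀ t x, 0 ≤ ℓ t x) (t : ℕ) :
    unnormFilter S.kernel (P.map (X 0)) ℓ t =
      (P.withDensity fun ω =>
        ENNReal.ofReal (∏ s ∈ Finset.range t, ℓ s (X (s + 1) ω))).map (X t) := by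
  have hX := h.measurable_state
  have hprod : ∀ t, Measurable[history X t]
      fun ω => ENNReal.ofReal (∏ s ∈ Finset.range t, ℓ s (X (s + 1) ω)) := fun t =>
    (Finset.measurable_prod _ fun s hs => (hℓ s).comp
      (measurable_history X (Finset.mem_range.1 hs))).ennreal_ofReal
  have hprod' := fun t => (hprod t).mono (history_le hX t) le_rfl
  induction t with
  | zero => simp [unnormFilter, withDensity_const]
  | succ t ih =>
    have hbind : (unnormFilter S.kernel (P.map (X 0)) ℓ t).bind S.kernel =
        (P.withDensity fun ω =>
          ENNReal.ofReal (∏ s ∈ Finset.range t, ℓ s (X (s + 1) ω))).map (X (t + 1)) := by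
      ext A hA
      have hk : Measurable fun ω => S.kernel (X t ω) A :=
        (S.kernel.measurable_coe hA).comp (hX t)
      rw [Measure.bind_apply hA S.kernel.aemeasurable, ih,
        lintegral_map (S.kernel.measurable_coe hA) (hX t), Measure.map_apply (hX _) hA,
        withDensity_apply _ (hX _ hA), lintegral_markov h t hA (hprod t),
        lintegral_withDensity_eq_lintegral_mul _ (hprod' t) hk]
      rfl
    have hcomp : Measurable fun ω => ENNReal.ofReal (ℓ t (X (t + 1) ω)) :=
      ((hℓ t).comp (hX _)).ennreal_ofReal
    rw [unnormFilter, hbind]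
    ext A hA
    rw [withDensity_apply _ hA, setLIntegral_map hA (hℓ t).ennreal_ofReal (hX _),
      Measure.map_apply (hX _) hA, withDensity_apply _ (hX _ hA),
      restrict_withDensity (hX _ hA),
      lintegral_withDensity_eq_lintegral_mul _ (hprod' t) hcomp]
    refine lintegral_congr fun ω => ?_
    rw [Pi.mul_apply, Finset.prod_range_succ,
      ENNReal.ofReal_mul (Finset.prod_nonneg fun s _ => h0 s _)]

lemma integral_unnormFilter [IsFiniteMeasure P] (h : IsRealization S P X y)
    {ℓ : ℕ → (Fin M → ℝ) → ℝ} (hℓ : ∀ t, Measurable (ℓ t)) (h0 : ∀ t x, 0 ≤ ℓ t x) (t : ℕ)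
    {g : (Fin M → ℝ) → ℝ} (hg : Measurable g) :
    ∫ x, g x ∂(unnormFilter S.kernel (P.map (X 0)) ℓ t) =
      ∫ ω, (∏ s ∈ Finset.range t, ℓ s (X (s + 1) ω)) * g (X t ω) ∂P := by
  rw [unnormFilter_eq_map h hℓ h0, integral_map (h.measurable_state t).aemeasurable
    hg.aestronglyMeasurable, integral_withDensity_ofReal
    (f := fun ω => ∏ s ∈ Finset.range t, ℓ s (X (s + 1) ω))
    (Finset.measurable_prod _ fun s _ => (hℓ s).comp (h.measurable_state _))
    (fun ω => Finset.prod_nonneg fun s _ => h0 s _)]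

end markov

/-! ### The joint law of the state process and the observations -/

lemma lintegral_fin_prod_eq_prod {n : ℕ} {E : Fin n → Type*} {mE : ∀ i, MeasurableSpace (E i)}
    {μ : (i : Fin n) → Measure (E i)} [∀ i, SigmaFinite (μ i)] {f : (i : Fin n) → E i → ℝ≥0∞}
    (hf : ∀ i, Measurable (f i)) :
    ∫⁻ x, ∏ i, f i (x i) ∂(Measure.pi μ) = ∏ i, ∫⁻ x, f i x ∂(μ i) := by
  induction n with
  | zero => simp
  | succ n ih =>
    rw [← ((measurePreserving_piFinSuccAbove μ 0).symm).lintegral_comp_emb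
      (MeasurableEquiv.measurableEmbedding _)]
    have h1 : ∀ p, (∏ i, f i ((MeasurableEquiv.piFinSuccAbove E 0).symm p i)) =
        f 0 p.1 * ∏ i : Fin n, f (Fin.succ i) (p.2 i) := fun p => by
      rw [Fin.prod_univ_succ]; rfl
    rw [Fin.prod_univ_succ, ← ih (fun i : Fin n => hf (Fin.succ i)), lintegral_congr h1]
    exact lintegral_prod_mul (μ := μ 0) (ν := Measure.pi fun i : Fin n => μ i.succ)
      (hf 0).aemeasurable
      (Finset.measurable_fun_prod _ fun (i : Fin n) _ =>
        (hf (Fin.succ i)).comp (measurable_pi_apply i)).aemeasurable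

/-- The density of the observations up to time `T`, given the path of the state. -/
def System.pathPdf (S : System M N) (T : ℕ) (x : ℕ → Fin M → ℝ) (v : Fin (T + 1) → Fin N → ℝ) :
    ℝ :=
  ∏ s : Fin (T + 1), S.obsPdf s (x (s + 1)) (v s)

section joint

variable {S : System M N} {P : Measure Ω} {X : ℕ → Ω → (Fin M → ℝ)} {y : ℕ → Ω → (Fin N → ℝ)}

lemma measurable_pathPdf (hS : S.Regular) (T : ℕ) :
    Measurable fun p : (ℕ → Fin M → ℝ) × (Fin (T + 1) → Fin N → ℝ) => S.pathPdf T p.1 p.2 := by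
  unfold System.pathPdf
  refine Finset.measurable_fun_prod _ fun s _ => ?_
  have h1 : Measurable fun p : (ℕ → Fin M → ℝ) × (Fin (T + 1) → Fin N → ℝ) =>
      (p.1 ((s : ℕ) + 1), p.2 s) :=
    ((measurable_pi_apply ((s : ℕ) + 1)).comp measurable_fst).prodMk
      ((measurable_pi_apply s).comp measurable_snd)
  have h2 := (System.continuous_obsPdf hS (s : ℕ)).measurable.comp h1
  exact h2

lemma pathPdf_pos (hS : S.Regular) (T : ℕ) (x : ℕ → Fin M → ℝ) (v : Fin (T + 1) → Fin N → ℝ) :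
    0 < S.pathPdf T x v :=
  Finset.prod_pos fun _ _ => System.obsPdf_pos hS _ _ _

lemma pathPdf_le (hS : S.Regular) (T : ℕ) (x : ℕ → Fin M → ℝ) (v : Fin (T + 1) → Fin N → ℝ) :
    S.pathPdf T x v ≤ (((√(2 * Real.pi)) ^ N)⁻¹) ^ (T + 1) := by
  refine (Finset.prod_le_prod (fun _ _ => (System.obsPdf_pos hS _ _ _).le)
    fun _ _ => System.obsPdf_le hS _ _ _).trans_eq ?_
  simp

lemma measurable_path (h : IsRealization S P X y) : Measurable fun ω s => X s ω :=
  measurable_pi_lambda _ h.measurable_state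

lemma measurable_obs_path (h : IsRealization S P X y) (T : ℕ) :
    Measurable fun ω (s : Fin (T + 1)) => y s ω :=
  measurable_pi_lambda _ fun s => h.measurable_obs s

lemma measure_path_inter (h : IsRealization S P X y) (T : ℕ)
    {A : Set (ℕ → Fin M → ℝ)} (hA : MeasurableSet A) {B : Fin (T + 1) → Set (Fin N → ℝ)}
    (hB : ∀ s, MeasurableSet (B s)) :
    P ((fun ω s => X s ω) ⁻¹' A ∩ (fun ω (s : Fin (T + 1)) => y s ω) ⁻¹' Set.univ.pi B) =
      ∫⁻ ω in (fun ω s => X s ω) ⁻¹' A, (∏ s : Fin (T + 1), ∫⁻ v in B s,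
        ENNReal.ofReal (S.obsPdf s (X (s + 1) ω) v)) ∂P := by
  -- The hypothesis asks for infinitely many sets; beyond `T` they play no role and are filled up by
  -- the whole space.
  have h1 := h.obs_law T A (fun s => if hs : s < T + 1 then B ⟨s, hs⟩ else Set.univ) hA
    fun s => by
      split_ifs
      · exact hB _
      · exact MeasurableSet.univ
  have h2 : (fun ω (s : Fin (T + 1)) => y s ω) ⁻¹' Set.univ.pi B =
      ⋂ t ∈ Finset.range (T + 1), y t ⁻¹' (if hs : t < T + 1 then B ⟨t, hs⟩ else Set.univ) := by
    ext ω
    simp only [Set.mem_preimage, Set.mem_pi, Set.mem_univ, true_implies, Set.mem_iInter,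
      Finset.mem_range]
    refine ⟨fun hω t ht => by rw [dif_pos ht]; exact hω ⟨t, ht⟩, fun hω s => ?_⟩
    have := hω s s.2
    rwa [dif_pos s.2] at this
  rw [h2]
  refine h1.trans (lintegral_congr_ae (ae_restrict_of_ae ?_))
  filter_upwards [ae_all_iff.2 h.mem_cube] with ω hω
  rw [Finset.prod_range]
  refine Finset.prod_congr rfl fun s _ => ?_
  rw [dif_pos s.2, gaussLaw, withDensity_apply _ (hB _)]
  exact lintegral_congr fun v => by rw [System.obsPdf_of_mem (hω _)]

/-- Both sides agree on the sets `A × ∏ B s` by conditional independence and Tonelli; these form a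
generating π-system, and the measures have the same finite total mass. -/
lemma map_path_obs [IsProbabilityMeasure P] (hS : S.Regular) (h : IsRealization S P X y) (T : ℕ) :
    P.map (fun ω => ((fun s => X s ω), fun s : Fin (T + 1) => y s ω)) =
      ((P.map fun ω s => X s ω).prod volume).withDensity
        fun p => ENNReal.ofReal (S.pathPdf T p.1 p.2) := by
  have hX := measurable_path h
  have hy := measurable_obs_path h T
  have hXy := hX.prodMk hy
  have := Measure.isProbabilityMeasure_map (μ := P) hXy.aemeasurable
  have hgen : ∀ (A : Set (ℕ → Fin M → ℝ)) (B : Fin (T + 1) → Set (Fin N → ℝ)),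
      MeasurableSet A → (∀ s, MeasurableSet (B s)) →
      P.map (fun ω => ((fun s => X s ω), fun s : Fin (T + 1) => y s ω)) (A ×ˢ Set.univ.pi B) =
      (((P.map fun ω s => X s ω).prod volume).withDensity
        fun p => ENNReal.ofReal (S.pathPdf T p.1 p.2)) (A ×ˢ Set.univ.pi B) := by
    intro A B hA hB
    have hB' := MeasurableSet.univ_pi hB
    rw [Measure.map_apply hXy (hA.prod hB'), Set.mk_preimage_prod, measure_path_inter h T hA hB,
      withDensity_apply _ (hA.prod hB'), ← Measure.prod_restrict,
      lintegral_prod _ (measurable_pathPdf hS T).ennreal_ofReal.aemeasurable,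
      setLIntegral_map hA (measurable_pathPdf hS T).ennreal_ofReal.lintegral_prod_right' hX]
    refine lintegral_congr fun ω => ?_
    have hvol : (volume : Measure (Fin (T + 1) → Fin N → ℝ)).restrict (Set.univ.pi B) =
        Measure.pi fun s => (volume : Measure (Fin N → ℝ)).restrict (B s) := by
      rw [volume_pi, Measure.restrict_pi_pi]
    have hmeas : ∀ s : Fin (T + 1), Measurable fun v =>
        ENNReal.ofReal (S.obsPdf s (X (s + 1) ω) v) := fun s =>
      ((System.continuous_obsPdf hS s).measurable.comp measurable_prodMk_left).ennreal_ofReal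
    rw [hvol, ← lintegral_fin_prod_eq_prod hmeas]
    refine lintegral_congr fun v => ?_
    rw [System.pathPdf, ENNReal.ofReal_prod_of_nonneg fun s _ => (System.obsPdf_pos hS _ _ _).le]
  have hprod := generateFrom_eq_prod (α := ℕ → Fin M → ℝ) (β := Fin (T + 1) → Fin N → ℝ)
    MeasurableSpace.generateFrom_measurableSet
    (generateFrom_eq_pi (α := fun _ : Fin (T + 1) => Fin N → ℝ)
      (fun _ => MeasurableSpace.generateFrom_measurableSet) fun _ => isCountablySpanning_measurableSet)
    isCountablySpanning_measurableSet
    (IsCountablySpanning.pi fun _ => isCountablySpanning_measurableSet)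
  refine ext_of_generate_finite _ hprod.symm
    (MeasurableSpace.isPiSystem_measurableSet.prod (IsPiSystem.pi fun _ => MeasurableSpace.isPiSystem_measurableSet)) ?_ ?_
  · rintro _ ⟨A, hA, _, ⟨B, hB, rfl⟩, rfl⟩
    exact hgen A B hA fun s => hB s trivial
  · have := hgen Set.univ (fun _ => Set.univ) MeasurableSet.univ fun _ => MeasurableSet.univ
    simpa using this

end joint

/-! ### Bayes' formula -/

section bayes

variable {α β : Type*} [MeasurableSpace α] [MeasurableSpace β] {P : Measure Ω}
  [IsProbabilityMeasure P] {U : Ω → α} {V : Ω → β} {ρ : Measure α} [IsProbabilityMeasure ρ]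
  {η : Measure β} [SigmaFinite η] {q : α × β → ℝ}

lemma integral_comp_of_joint_density (hU : Measurable U) (hV : Measurable V) (hq : Measurable q)
    (h0 : ∀ p, 0 < q p)
    (hJ : P.map (fun ω => (U ω, V ω)) = (ρ.prod η).withDensity fun p => ENNReal.ofReal (q p))
    {f : α × β → ℝ} (hf : Measurable f) {B : ℝ} (hB : ∀ p, |f p| ≤ B) :
    ∫ ω, f (U ω, V ω) ∂P = ∫ v, ∫ x, q (x, v) * f (x, v) ∂ρ ∂η := by
  -- The integral of `q` is the total mass of the joint law.
  have hqi : Integrable q (ρ.prod η) := by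
    refine ⟨hq.aestronglyMeasurable, ?_⟩
    rw [hasFiniteIntegral_iff_ofReal (ae_of_all _ fun p => (h0 p).le), ← setLIntegral_univ,
      ← withDensity_apply _ MeasurableSet.univ, ← hJ]
    have := Measure.isProbabilityMeasure_map (μ := P) (hU.prodMk hV).aemeasurable
    exact measure_lt_top _ _
  have hqf : Integrable (fun p => q p * f p) (ρ.prod η) :=
    hqi.mul_bdd hf.aestronglyMeasurable (ae_of_all _ hB)
  rw [← integral_map (hU.prodMk hV).aemeasurable hf.aestronglyMeasurable, hJ,
    integral_withDensity_ofReal hq fun p => (h0 p).le]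
  exact integral_prod_symm _ hqf

/-- **Bayes' formula** for a joint density which is positive and bounded. -/
lemma condExp_eq_of_joint_density (hU : Measurable U) (hV : Measurable V) (hq : Measurable q)
    (h0 : ∀ p, 0 < q p) {C : ℝ} (hC : ∀ p, q p ≤ C)
    (hJ : P.map (fun ω => (U ω, V ω)) = (ρ.prod η).withDensity fun p => ENNReal.ofReal (q p))
    {g : α → ℝ} (hg : Measurable g) {B : ℝ} (hB : ∀ x, |g x| ≤ B) :
    (fun ω => (∫ x, q (x, V ω) * g x ∂ρ) / ∫ x, q (x, V ω) ∂ρ) =ᵐ[P]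
      P[fun ω => g (U ω) | MeasurableSpace.comap V inferInstance] := by
  have hgU : Measurable fun ω => g (U ω) := hg.comp hU
  have hqv : ∀ v, Integrable (fun x => q (x, v)) ρ := fun v =>
    .of_bound (hq.comp measurable_prodMk_right).aestronglyMeasurable C (ae_of_all _ fun x => by
      rw [Real.norm_of_nonneg (h0 _).le]; exact hC _)
  -- Strict positivity of `q` makes the normalizer positive for every `v`, not merely almost every.
  have hpos : ∀ v, 0 < ∫ x, q (x, v) ∂ρ := fun v => by
    rw [integral_pos_iff_support_of_nonneg (fun x => (h0 _).le) (hqv v),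
      Function.support_eq_univ fun x => (h0 _).ne']
    simp
  set R : β → ℝ := fun v => (∫ x, q (x, v) * g x ∂ρ) / ∫ x, q (x, v) ∂ρ with hR
  have hRm : Measurable R := by
    refine Measurable.div ?_ ?_
    · exact (StronglyMeasurable.integral_prod_left' (μ := ρ) (f := fun p => q p * g p.1)
        (hq.mul (hg.comp measurable_fst)).stronglyMeasurable).measurable
    · exact (StronglyMeasurable.integral_prod_left' (μ := ρ) hq.stronglyMeasurable).measurable
  have hRB : ∀ v, |R v| ≤ B := by
    intro v
    rw [hR, abs_div, abs_of_pos (hpos v), div_le_iff₀ (hpos v), ← integral_const_mul,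
      ← Real.norm_eq_abs]
    refine norm_integral_le_of_norm_le ((hqv v).const_mul B) (ae_of_all _ fun x => ?_)
    rw [norm_mul, Real.norm_of_nonneg (h0 _).le, mul_comm]
    exact mul_le_mul_of_nonneg_right (hB x) (h0 _).le
  have hRi : Integrable (fun ω => R (V ω)) P :=
    .of_bound (hRm.comp hV).aestronglyMeasurable B (ae_of_all _ fun ω => hRB _)
  refine ae_eq_condExp_of_forall_setIntegral_eq hV.comap_le
    (.of_bound hgU.aestronglyMeasurable B (ae_of_all _ fun ω => hB _))
    (fun s _ _ => hRi.integrableOn) ?_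
    (hRm.comp (comap_measurable V)).aestronglyMeasurable
  rintro _ ⟨D, hD, rfl⟩ -
  rw [← integral_indicator (hV hD), ← integral_indicator (hV hD)]
  have hB0 : ∀ (f : α × β → ℝ), (∀ p, |f p| ≤ B) → ∀ p,
      |(Prod.snd ⁻¹' D).indicator f p| ≤ B := fun f hf p => by
    by_cases hp : p ∈ Prod.snd ⁻¹' D
    · rw [Set.indicator_of_mem hp]; exact hf p
    · rw [Set.indicator_of_notMem hp, abs_zero]; exact (abs_nonneg _).trans (hf p)
  have h1 := integral_comp_of_joint_density hU hV hq h0 hJ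
    (f := (Prod.snd ⁻¹' D).indicator fun p => R p.2)
    ((hRm.comp measurable_snd).indicator (measurable_snd hD)) (hB0 _ fun p => hRB p.2)
  have h2 := integral_comp_of_joint_density hU hV hq h0 hJ
    (f := (Prod.snd ⁻¹' D).indicator fun p => g p.1)
    ((hg.comp measurable_fst).indicator (measurable_snd hD)) (hB0 _ fun p => hB p.1)
  -- On `D` the normalizer cancels the denominator of `R`; off `D` both integrands vanish. This is
  -- the defining identity of the conditional expectation.
  have h3 : ∀ v, ∫ x, q (x, v) * (Prod.snd ⁻¹' D).indicator (fun p => R p.2) (x, v) ∂ρ =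
      ∫ x, q (x, v) * (Prod.snd ⁻¹' D).indicator (fun p => g p.1) (x, v) ∂ρ := by
    intro v
    by_cases hv : v ∈ D
    · have hmem : ∀ x : α, (x, v) ∈ (Prod.snd ⁻¹' D : Set (α × β)) := fun _ => hv
      simp only [Set.indicator_of_mem (hmem _)]
      rw [integral_mul_const, hR]
      exact mul_div_cancel₀ _ (hpos v).ne'
    · have hmem : ∀ x : α, (x, v) ∉ (Prod.snd ⁻¹' D : Set (α × β)) := fun _ => hv
      simp only [Set.indicator_of_notMem (hmem _)]
  refine Eq.trans ?_ ((h1.trans (integral_congr_ae (ae_of_all _ h3))).trans h2.symm |>.trans ?_)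
  · rfl
  · rfl

end bayes

/-! ### The optimal filter and the grid filter for fixed observations -/

/-- The scaled likelihoods of the states for the observations `v`, extended to `ℝ^M` by means of
the projection onto the cube. -/
def System.scaledLik (S : System M N) (v : ℕ → Fin N → ℝ) (t : ℕ) (x : Fin M → ℝ) : ℝ :=
  (√(2 * Real.pi)) ^ N * S.obsPdf t x (v t)

section filters

variable {S : System M N} {P : Measure Ω} {X : ℕ → Ω → (Fin M → ℝ)} {y : ℕ → Ω → (Fin N → ℝ)}

lemma continuous_scaledLik (hS : S.Regular) (v : ℕ → Fin N → ℝ) (t : ℕ) :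
    Continuous (S.scaledLik v t) :=
  continuous_const.mul ((System.continuous_obsPdf hS t).comp (Continuous.prodMk_left (v t)))

lemma scaledLik_pos (hS : S.Regular) (v : ℕ → Fin N → ℝ) (t : ℕ) (x : Fin M → ℝ) :
    0 < S.scaledLik v t x :=
  mul_pos (by positivity) (System.obsPdf_pos hS _ _ _)

lemma scaledLik_of_mem {x : Fin M → ℝ} (hx : x ∈ S.cube) (v : ℕ → Fin N → ℝ) (t : ℕ) :
    S.scaledLik v t x = S.lik t x (v t) := by
  rw [System.lik_of_mem hx, System.scaledLik]

lemma scaledLik_le_one (hS : S.Regular) (v : ℕ → Fin N → ℝ) (t : ℕ) (x : Fin M → ℝ) :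
    S.scaledLik v t x ≤ 1 := by
  have h : S.scaledLik v t x = S.scaledLik v t (S.clamp x) := by
    simp only [System.scaledLik, System.obsPdf,
      System.clamp_of_mem (System.clamp_mem hS.lt x)]
  rw [h, scaledLik_of_mem (System.clamp_mem hS.lt x)]
  exact System.lik_le_one hS t (System.clamp_mem hS.lt x) _

lemma history_eq_comap {Ω β : Type*} [MeasurableSpace β] (Z : ℕ → Ω → β) (T : ℕ) :
    history Z T = MeasurableSpace.comap (fun ω (s : Fin (T + 1)) => Z s ω) inferInstance := by
  refine le_antisymm (iSup₂_le fun s hs => ?_) (Measurable.comap_le ?_)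
  · exact ((measurable_pi_apply (⟨s, by omega⟩ : Fin (T + 1))).comp
      (comap_measurable (fun ω (s : Fin (T + 1)) => Z s ω))).comap_le
  · refine @measurable_pi_lambda _ _ _ (history Z T) _ _ fun s => ?_
    exact measurable_history Z (Nat.lt_succ_iff.1 s.2)

lemma prod_scaledLik (v : ℕ → Fin N → ℝ) (T : ℕ) (x : ℕ → Fin M → ℝ) :
    ∏ s ∈ Finset.range (T + 1), S.scaledLik v s (x (s + 1)) =
      ((√(2 * Real.pi)) ^ N) ^ (T + 1) * S.pathPdf T x fun s => v s := by
  simp only [System.scaledLik]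
  rw [Finset.prod_mul_distrib, Finset.prod_const, Finset.card_range, Finset.prod_range,
    System.pathPdf]

lemma measurable_pathPdf_left (hS : S.Regular) (T : ℕ) (v : Fin (T + 1) → Fin N → ℝ) :
    Measurable fun x => S.pathPdf T x v := by
  have h1 : Measurable fun x : ℕ → Fin M → ℝ => (x, v) := measurable_prodMk_right
  have h2 := (measurable_pathPdf hS T).comp h1
  exact h2

/-- Bayes' formula for the whole state path given `y_0, …, y_t`; the powers of `√(2π)` cancel in the
quotient. The state is clamped so that the conditioned function is bounded everywhere. -/
lemma condExp_state_ae_eq [IsProbabilityMeasure P] (hS : S.Regular) (h : IsRealization S P X y)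
    (t : ℕ) (m : Fin M) :
    ∀ᵐ ω ∂P, (P[fun ω => X (t + 1) ω m | history y t]) ω =
      (∫ x, x m ∂(unnormFilter S.kernel (P.map (X 0)) (S.scaledLik fun s => y s ω) (t + 1))) /
        ∫ _x, (1 : ℝ) ∂(unnormFilter S.kernel (P.map (X 0))
          (S.scaledLik fun s => y s ω) (t + 1)) := by
  have hX := measurable_path h
  have := Measure.isProbabilityMeasure_map (μ := P) hX.aemeasurable
  have hclamp : ∀ᵐ ω ∂P, S.clamp (X (t + 1) ω) m = X (t + 1) ω m := by
    filter_upwards [h.mem_cube (t + 1)] with ω hω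
    rw [System.clamp_of_mem hω]
  have hgm : Measurable fun x : ℕ → Fin M → ℝ => S.clamp (x (t + 1)) m :=
    (measurable_pi_apply m).comp (S.continuous_clamp.measurable.comp (measurable_pi_apply _))
  have h1 := condExp_eq_of_joint_density
    (q := fun p : (ℕ → Fin M → ℝ) × (Fin (t + 1) → Fin N → ℝ) => S.pathPdf t p.1 p.2)
    hX (measurable_obs_path h t) (measurable_pathPdf hS t)
    (fun p => pathPdf_pos hS t _ _) (fun p => pathPdf_le hS t _ _) (map_path_obs hS h t)
    hgm (B := max |S.a| |S.b|) fun x => norm_clamp_apply_le hS.lt _ m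
  rw [← history_eq_comap y t] at h1
  filter_upwards [h1, condExp_congr_ae (m := history y t) hclamp] with ω h2 h3
  have hℓ : ∀ s, Measurable (S.scaledLik (fun s => y s ω) s) := fun s =>
    (continuous_scaledLik hS _ s).measurable
  have hℓ0 : ∀ s x, 0 ≤ S.scaledLik (fun s => y s ω) s x := fun s x => (scaledLik_pos hS _ s x).le
  have hq : Measurable fun x : ℕ → Fin M → ℝ => S.pathPdf t x fun s => y s ω :=
    measurable_pathPdf_left hS t _
  rw [← h3, ← h2, integral_unnormFilter h hℓ hℓ0 _ (measurable_pi_apply m),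
    integral_unnormFilter h hℓ hℓ0 _ measurable_const,
    integral_map hX.aemeasurable (f := fun x => (S.pathPdf t x fun s => y s ω) *
      S.clamp (x (t + 1)) m) (hq.mul hgm).aestronglyMeasurable,
    integral_map hX.aemeasurable hq.aestronglyMeasurable]
  have h4 : ∀ ω', ∏ s ∈ Finset.range (t + 1), S.scaledLik (fun s => y s ω) s (X (s + 1) ω') =
      ((√(2 * Real.pi)) ^ N) ^ (t + 1) * S.pathPdf t (fun s => X s ω') fun s => y s ω :=
    fun ω' => prod_scaledLik (fun s => y s ω) t fun s => X s ω'
  simp only [h4, mul_assoc, mul_one]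
  rw [integral_const_mul, integral_const_mul, mul_div_mul_left _ _ (by positivity)]
  congr 1
  refine integral_congr_ae ?_
  filter_upwards [hclamp] with ω' h5
  rw [h5]

lemma mmse_apply_ae_eq [IsProbabilityMeasure P] (hS : S.Regular) (h : IsRealization S P X y)
    (t : ℕ) : ∀ᵐ ω ∂P, ∀ m, mmse P X y t ω m =
      (∫ x, x m ∂(unnormFilter S.kernel (P.map (X 0)) (S.scaledLik fun s => y s ω) (t + 1))) /
        ∫ _x, (1 : ℝ) ∂(unnormFilter S.kernel (P.map (X 0))
          (S.scaledLik fun s => y s ω) (t + 1)) := by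
  obtain ⟨B, hB⟩ := (isCompact_cube S).exists_bound_of_continuousOn continuousOn_id
  have hi : Integrable (X (t + 1)) P :=
    .of_bound (h.measurable_state _).aestronglyMeasurable B (by
      filter_upwards [h.mem_cube (t + 1)] with ω hω using hB _ hω)
  refine ae_all_iff.2 fun m => ?_
  filter_upwards [condExp_state_ae_eq hS h t m,
    (ContinuousLinearMap.proj (R := ℝ) (φ := fun _ : Fin M => ℝ) m).comp_condExp_comm
      (m := history y t) hi] with ω h1 h2
  rw [← h1]
  exact h2

lemma gridE_eq_gridVec [IsFiniteMeasure P] (hS : S.Regular) (h : IsRealization S P X y) {L : ℕ}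
    (hL : 1 ≤ L) (t : ℕ) (ω : Ω) : gridE S P X y L t ω =
      S.gridVec (P.map (X 0)) L (S.scaledLik fun s => y s ω) t := by
  induction t with
  | zero => exact funext fun j => initVec_apply hS h hL j
  | succ t ih =>
    funext i
    rw [gridE, ih, System.likMatrix, Matrix.mulVec_diagonal, System.gridVec]
    simp only [scaledLik_of_mem (center_mem_cube hS.lt i), Matrix.mulVec, dotProduct,
      transMatrix_apply hS h hL]

lemma gridE_nonneg [IsFiniteMeasure P] (hS : S.Regular) (h : IsRealization S P X y) {L : ℕ}
    (hL : 1 ≤ L) (t : ℕ) (ω : Ω) (j : Idx M L) : 0 ≤ gridE S P X y L t ω j := by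
  rw [gridE_eq_gridVec hS h hL]
  exact gridVec_nonneg (fun s i => scaledLik_pos hS _ s _) t j

lemma l1_gridE [IsFiniteMeasure P] (hS : S.Regular) (h : IsRealization S P X y) {L : ℕ}
    (hL : 1 ≤ L) (t : ℕ) (ω : Ω) :
    l1 (gridE S P X y L t ω) = ∑ j, gridE S P X y L t ω j :=
  Finset.sum_congr rfl fun j _ => abs_of_nonneg (gridE_nonneg hS h hL t ω j)

/-- The numerator is the case of a coordinate function, the denominator the case of the constant
`1`, with nonzero limit. No exceptional set of outcomes occurs here. -/
lemma tendsto_gridFilter_apply [IsProbabilityMeasure P] (hS : S.Regular)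
    (h : IsRealization S P X y) (hreg : S.GridRegular (P.map (X 0))) (t : ℕ) (ω : Ω)
    (m : Fin M) : Tendsto (fun L => gridFilter S P X y L t ω m) atTop
      (𝓝 ((∫ x, x m ∂(unnormFilter S.kernel (P.map (X 0))
        (S.scaledLik fun s => y s ω) (t + 1))) /
        ∫ _x, (1 : ℝ) ∂(unnormFilter S.kernel (P.map (X 0))
          (S.scaledLik fun s => y s ω) (t + 1)))) := by
  have := hS.markov
  have := Measure.isProbabilityMeasure_map (μ := P) (h.measurable_state 0).aemeasurable
  have hlim := fun {g : (Fin M → ℝ) → ℝ} (hg : Continuous g) =>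
    tendsto_sum_gridVec hS h.invariant (ae_mem_cube h) hreg
      (continuous_scaledLik hS fun s => y s ω) (scaledLik_pos hS fun s => y s ω)
      (scaledLik_le_one hS fun s => y s ω) (t + 1) hg
  have hle := unnormFilter_le h.invariant (scaledLik_le_one hS fun s => y s ω) (t + 1)
  have hfin := isFiniteMeasure_of_le _ hle
  have hne := unnormFilter_ne_zero (S := S) (IsProbabilityMeasure.ne_zero (P.map (X 0)))
    (fun s => (continuous_scaledLik hS (fun s => y s ω) s).measurable)
    (scaledLik_pos hS fun s => y s ω) (t + 1)
  have hpos : (∫ _x, (1 : ℝ) ∂(unnormFilter S.kernel (P.map (X 0))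
      (S.scaledLik fun s => y s ω) (t + 1))) ≠ 0 := by
    rw [integral_const, smul_eq_mul, mul_one]
    have : NeZero (unnormFilter S.kernel (P.map (X 0))
      (S.scaledLik fun s => y s ω) (t + 1)) := ⟨hne⟩
    exact measureReal_univ_ne_zero
  refine ((hlim (continuous_apply m)).div (hlim continuous_const) hpos).congr' ?_
  filter_upwards [eventually_ge_atTop 1] with L hL
  simp only [gridFilter, Pi.smul_apply, smul_eq_mul, Pi.div_apply]
  rw [l1_gridE hS h hL, gridE_eq_gridVec hS h hL, div_eq_inv_mul]
  simp [Matrix.mulVec, dotProduct, System.recon]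

lemma ae_tendsto_l1_gridFilter [IsProbabilityMeasure P] (hS : S.Regular)
    (h : IsRealization S P X y)
    (hreg : IsCRT1 S (P.map (X 0)) ∨ IsCRT2 S (P.map (X 0))) (t : ℕ) :
    ∀ᵐ ω ∂P, Tendsto (fun L => l1 (gridFilter S P X y L t ω - mmse P X y t ω)) atTop (𝓝 0) := by
  have := Measure.isProbabilityMeasure_map (μ := P) (h.measurable_state 0).aemeasurable
  filter_upwards [mmse_apply_ae_eq hS h t] with ω hω
  have h1 : ∀ m ∈ Finset.univ, Tendsto (fun L => |gridFilter S P X y L t ω m - mmse P X y t ω m|)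
      atTop (𝓝 0) := by
    intro m _
    -- The existence of a coordinate excludes `M = 0`, in which case the `ℓ₁`-norm is an empty sum.
    have hM : M ≠ 0 := m.pos.ne'
    have hgr : S.GridRegular (P.map (X 0)) :=
      hreg.elim (fun h' => h'.gridRegular hM) fun h' => h'.gridRegular hS hM
    rw [hω m]
    have := ((tendsto_gridFilter_apply hS h hgr t ω m).sub_const
      ((∫ x, x m ∂(unnormFilter S.kernel (P.map (X 0)) (S.scaledLik fun s => y s ω) (t + 1))) /
        ∫ _x, (1 : ℝ) ∂(unnormFilter S.kernel (P.map (X 0))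
          (S.scaledLik fun s => y s ω) (t + 1)))).abs
    simpa using this
  simpa [l1] using tendsto_finsetSum _ h1

end filters

/-! ### The reference measure -/

lemma integrable_gaussPdf_standard : Integrable (gaussPdf (0 : Fin N → ℝ) 1) := by
  have h1 : ∀ v : Fin N → ℝ, gaussPdf 0 1 v =
      (√((2 * Real.pi) ^ N * (1 : Matrix (Fin N) (Fin N) ℝ).det))⁻¹ *
        ∏ i, Real.exp (-(1 / 2) * v i ^ 2) := by
    intro v
    rw [gaussPdf, ← Real.exp_sum, ← Finset.mul_sum]
    simp [dotProduct, sq]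
  rw [funext h1]
  refine Integrable.const_mul ?_ _
  exact Integrable.fintype_prod (f := fun (_ : Fin N) (x : ℝ) => Real.exp (-(1 / 2) * x ^ 2))
    (μ := fun _ => volume) fun _ => integrable_exp_neg_mul_sq (by norm_num)

section reference

variable {S : System M N} {P : Measure Ω} {X : ℕ → Ω → (Fin M → ℝ)} {y : ℕ → Ω → (Fin N → ℝ)}

lemma likRatio_inv_ae_eq (h : IsRealization S P X y) (T : ℕ) :
    (fun ω => (likRatio S X y T ω)⁻¹) =ᵐ[P] fun ω =>
      (∏ s : Fin (T + 1), gaussPdf 0 1 (y s ω)) /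
        S.pathPdf T (fun s => X s ω) fun s => y s ω := by
  filter_upwards [ae_all_iff.2 h.mem_cube] with ω hω
  rw [likRatio, Finset.prod_div_distrib, inv_div, Finset.prod_range, Finset.prod_range,
    System.pathPdf]
  congr 1
  exact Finset.prod_congr rfl fun s _ => by rw [System.obsPdf_of_mem (hω _)]

lemma measurable_standard_div_pathPdf (hS : S.Regular) (T : ℕ) :
    Measurable fun p : (ℕ → Fin M → ℝ) × (Fin (T + 1) → Fin N → ℝ) =>
      (∏ s, gaussPdf 0 1 (p.2 s)) / S.pathPdf T p.1 p.2 := by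
  refine Measurable.div (Finset.measurable_fun_prod _ fun s _ => ?_) (measurable_pathPdf hS T)
  exact (measurable_gaussPdf 0 1).comp ((measurable_pi_apply s).comp measurable_snd)

lemma aemeasurable_likRatio_inv (hS : S.Regular) (h : IsRealization S P X y) (T : ℕ) :
    AEMeasurable (fun ω => ENNReal.ofReal (likRatio S X y T ω)⁻¹) P := by
  refine AEMeasurable.ennreal_ofReal ⟨_, ?_, likRatio_inv_ae_eq h T⟩
  have h1 := (measurable_path h).prodMk (measurable_obs_path h T)
  have h2 := (measurable_standard_div_pathPdf hS T).comp h1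
  exact h2

/-- Under the joint law the path density cancels against its inverse; what remains is a product of
standard Gaussian densities integrated against Lebesgue measure. -/
lemma isFiniteMeasure_refMeasure [IsProbabilityMeasure P] (hS : S.Regular)
    (h : IsRealization S P X y) (T : ℕ) : IsFiniteMeasure (refMeasure S P X y T) := by
  have hX := measurable_path h
  have hy := measurable_obs_path h T
  have := Measure.isProbabilityMeasure_map (μ := P) hX.aemeasurable
  have hm := (measurable_standard_div_pathPdf (M := M) (N := N) hS T).ennreal_ofReal
  refine isFiniteMeasure_withDensity ?_
  have h1 : ∫⁻ ω, ENNReal.ofReal (likRatio S X y T ω)⁻¹ ∂P =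
      ∫⁻ p, ENNReal.ofReal ((∏ s, gaussPdf 0 1 (p.2 s)) / S.pathPdf T p.1 p.2)
        ∂(P.map fun ω => ((fun s => X s ω), fun s : Fin (T + 1) => y s ω)) := by
    rw [lintegral_map hm (hX.prodMk hy)]
    refine lintegral_congr_ae ?_
    filter_upwards [likRatio_inv_ae_eq h T] with ω hω
    rw [hω]
  have h2 : ∫⁻ p, ENNReal.ofReal ((∏ s, gaussPdf 0 1 (p.2 s)) / S.pathPdf T p.1 p.2)
        ∂(P.map fun ω => ((fun s => X s ω), fun s : Fin (T + 1) => y s ω)) =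
      ∫⁻ p, ∏ s, ENNReal.ofReal (gaussPdf 0 1 (p.2 s))
        ∂((P.map fun ω s => X s ω).prod (volume : Measure (Fin (T + 1) → Fin N → ℝ))) := by
    rw [map_path_obs hS h T, lintegral_withDensity_eq_lintegral_mul _
      (measurable_pathPdf hS T).ennreal_ofReal hm]
    refine lintegral_congr fun p => ?_
    rw [Pi.mul_apply, ← ENNReal.ofReal_mul (pathPdf_pos hS T _ _).le,
      mul_div_cancel₀ _ (pathPdf_pos hS T _ _).ne',
      ENNReal.ofReal_prod_of_nonneg fun s _ => gaussPdf_nonneg _ _ _]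
  have hg : ∀ _ : Fin (T + 1), Measurable fun v : Fin N → ℝ => ENNReal.ofReal (gaussPdf 0 1 v) :=
    fun _ => (measurable_gaussPdf 0 1).ennreal_ofReal
  have hg' : Measurable fun p : (ℕ → Fin M → ℝ) × (Fin (T + 1) → Fin N → ℝ) =>
      ∏ s, ENNReal.ofReal (gaussPdf 0 1 (p.2 s)) :=
    Finset.measurable_fun_prod _ fun s _ =>
      (hg s).comp ((measurable_pi_apply s).comp measurable_snd)
  rw [h1, h2, lintegral_prod _ hg'.aemeasurable]
  simp only [lintegral_const, measure_univ, mul_one]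
  rw [volume_pi, lintegral_fin_prod_eq_prod hg]
  exact ENNReal.prod_ne_top fun s _ => integrable_gaussPdf_standard.lintegral_lt_top.ne

lemma absolutelyContinuous_refMeasure (hS : S.Regular) (h : IsRealization S P X y) (T : ℕ) :
    P ≪ refMeasure S P X y T := by
  refine withDensity_absolutelyContinuous' (aemeasurable_likRatio_inv hS h T) ?_
  filter_upwards [likRatio_inv_ae_eq h T] with ω hω
  rw [hω, ne_eq, ENNReal.ofReal_eq_zero, not_le]
  exact div_pos (Finset.prod_pos fun s _ => gaussPdf_pos (by simp) _ _) (pathPdf_pos hS T _ _)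

end reference

/-! ### Sums over the paths of a finite chain -/

section paths

variable {I : Type*} [Fintype I]

/-- The iterates `Q_{n-1} ⋯ Q_0 v`. -/
def mulVecIter (Q : ℕ → Matrix I I ℝ) (v : I → ℝ) : ℕ → I → ℝ
  | 0 => v
  | n + 1 => Q n *ᵥ mulVecIter Q v n

/-- Summing out the last state replaces `g` by the transpose of `Q n` applied to `g`, which reduces
the number of steps by one; hence the induction over all `g`. -/
lemma sum_paths_eq (Q : ℕ → Matrix I I ℝ) (v : I → ℝ) (n : ℕ) (g : I → ℝ) :
    ∑ z : Fin (n + 1) → I, v (z 0) * (∏ k : Fin n, Q k (z k.succ) (z k.castSucc)) *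
      g (z (Fin.last n)) = ∑ i, mulVecIter Q v n i * g i := by
  induction n generalizing g with
  | zero =>
    rw [← (Equiv.funUnique (Fin 1) I).symm.sum_comp]
    simp [mulVecIter]
  | succ n ih =>
    rw [← (Fin.snocEquiv fun _ : Fin (n + 2) => I).sum_comp, Fintype.sum_prod_type_right]
    have h1 : ∀ z : Fin (n + 1) → I, ∑ i : I,
        v ((Fin.snocEquiv fun _ : Fin (n + 2) => I) (i, z) 0) *
          (∏ k : Fin (n + 1), Q k ((Fin.snocEquiv fun _ : Fin (n + 2) => I) (i, z) k.succ)
            ((Fin.snocEquiv fun _ : Fin (n + 2) => I) (i, z) k.castSucc)) *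
          g ((Fin.snocEquiv fun _ : Fin (n + 2) => I) (i, z) (Fin.last (n + 1))) =
        v (z 0) * (∏ k : Fin n, Q k (z k.succ) (z k.castSucc)) *
          (∑ i, Q n i (z (Fin.last n)) * g i) := by
      intro z
      rw [Finset.mul_sum]
      refine Finset.sum_congr rfl fun i _ => ?_
      have h0 : (0 : Fin (n + 2)) = Fin.castSucc 0 := rfl
      simp only [Fin.snocEquiv_apply, Fin.prod_univ_castSucc, Fin.snoc_last, Fin.snoc_castSucc,
        Fin.succ_last, ← Fin.castSucc_succ, h0, Fin.val_castSucc, Fin.val_last]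
      ring
    rw [Finset.sum_congr rfl fun z _ => h1 z, ih fun j => ∑ i, Q n i j * g i]
    simp only [mulVecIter, Matrix.mulVec, dotProduct, Finset.mul_sum, Finset.sum_mul]
    rw [Finset.sum_comm]
    exact Finset.sum_congr rfl fun i _ => Finset.sum_congr rfl fun j _ => by ring

end paths

/-! ### The auxiliary chain -/

section chain

variable {S : System M N} {P : Measure Ω} {X : ℕ → Ω → (Fin M → ℝ)} {y : ℕ → Ω → (Fin N → ℝ)}
  {L : ℕ}

/-- The vector vanishes on the cells of probability zero. -/
def System.SupportedOn (S : System M N) (ν : Measure (Fin M → ℝ)) (v : Idx M L → ℝ) : Prop :=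
  ∀ j, ν.real (S.cell L j) = 0 → v j = 0

/-- Columns of null cells are zero instead of summing to `1`, so total mass is preserved only for
vectors that vanish on those cells. -/
lemma sum_transMatrix_mulVec [IsProbabilityMeasure P] (hS : S.Regular)
    (h : IsRealization S P X y) (hL : 1 ≤ L) {v : Idx M L → ℝ}
    (hv : S.SupportedOn (P.map (X 0)) v) :
    ∑ i, (transMatrix S P X L *ᵥ v) i = ∑ j, v j := by
  have := hS.markov
  have := Measure.isProbabilityMeasure_map (μ := P) (h.measurable_state 0).aemeasurable
  simp only [Matrix.mulVec, dotProduct]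
  rw [Finset.sum_comm]
  refine Finset.sum_congr rfl fun j _ => ?_
  rw [← Finset.sum_mul]
  by_cases hj : (P.map (X 0)).real (S.cell L j) = 0
  · rw [hv j hj, mul_zero]
  · simp only [transMatrix_apply hS h hL]
    rw [sum_cumKernel hS.lt hL h.invariant (ae_mem_cube h) j hj, one_mul]

lemma supportedOn_transMatrix_mulVec [IsProbabilityMeasure P] (hS : S.Regular)
    (h : IsRealization S P X y) (hL : 1 ≤ L) (v : Idx M L → ℝ) :
    S.SupportedOn (P.map (X 0)) (transMatrix S P X L *ᵥ v) := by
  have := Measure.isProbabilityMeasure_map (μ := P) (h.measurable_state 0).aemeasurable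
  intro i hi
  simp only [Matrix.mulVec, dotProduct]
  refine Finset.sum_eq_zero fun j _ => ?_
  rw [transMatrix_apply hS h hL,
    cumKernel_eq_zero h.invariant (measurableSet_cell S L i) hi, zero_mul]

lemma supportedOn_gridE [IsProbabilityMeasure P] (hS : S.Regular) (h : IsRealization S P X y)
    (hL : 1 ≤ L) (t : ℕ) (ω : Ω) : S.SupportedOn (P.map (X 0)) (gridE S P X y L t ω) := by
  cases t with
  | zero => exact fun j hj => (initVec_apply hS h hL j).trans hj
  | succ t =>
    intro j hj
    rw [gridE, System.likMatrix, Matrix.mulVec_diagonal,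
      supportedOn_transMatrix_mulVec hS h hL _ j hj, mul_zero]

lemma sum_initVec [IsProbabilityMeasure P] (hS : S.Regular) (h : IsRealization S P X y)
    (hL : 1 ≤ L) : ∑ j, initVec S P X L j = 1 := by
  have := Measure.isProbabilityMeasure_map (μ := P) (h.measurable_state 0).aemeasurable
  simp only [initVec_apply hS h hL]
  rw [sum_measureReal_cell hS.lt hL _ (measure_ne_top _ _), Measure.real,
    (prob_compl_eq_zero_iff (measurableSet_cube S)).1 (ae_mem_cube h), ENNReal.toReal_one]

/-- The transition matrix preserves the positive total mass, so some entry stays positive after the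
transition, and the likelihood there is positive. -/
lemma sum_gridE_pos [IsProbabilityMeasure P] (hS : S.Regular) (h : IsRealization S P X y)
    (hL : 1 ≤ L) (t : ℕ) (ω : Ω) : 0 < ∑ j, gridE S P X y L t ω j := by
  induction t with
  | zero => exact (sum_initVec hS h hL).symm ▸ zero_lt_one
  | succ t ih =>
    rw [← sum_transMatrix_mulVec hS h hL (supportedOn_gridE hS h hL t ω)] at ih
    obtain ⟨i, -, hi⟩ := Finset.exists_lt_of_sum_lt (f := fun _ => (0 : ℝ)) (by simpa using ih)
    refine Finset.sum_pos' (fun j _ => gridE_nonneg hS h hL (t + 1) ω j) ⟨i, Finset.mem_univ i, ?_⟩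
    rw [gridE, System.likMatrix, Matrix.mulVec_diagonal]
    exact mul_pos (System.lik_pos hS t (center_mem_cube hS.lt i) _) hi

/-- The probability of a path of the auxiliary chain. -/
def chainWeight (S : System M N) (P : Measure Ω) (X : ℕ → Ω → (Fin M → ℝ)) (L T : ℕ)
    (z : Fin (T + 2) → Idx M L) : ℝ :=
  initVec S P X L (z 0) * ∏ k : Fin (T + 1), transMatrix S P X L (z k.succ) (z k.castSucc)

lemma chainWeight_nonneg (T : ℕ) (z : Fin (T + 2) → Idx M L) : 0 ≤ chainWeight S P X L T z :=
  mul_nonneg measureReal_nonneg (Finset.prod_nonneg fun _ _ => measureReal_nonneg)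

/-- The sum over the paths of the chain, weighted by the likelihoods up to time `t`, of the
paths which are in the state `j` at time `t`. -/
lemma sum_chainWeight_lik [IsProbabilityMeasure P] (hS : S.Regular) (h : IsRealization S P X y)
    (hL : 1 ≤ L) (T : ℕ) (t : Fin (T + 1)) (ω : Ω) (j : Idx M L) :
    ∑ z, chainWeight S P X L T z * (auxLik S y L T t (ω, z) *
      (Pi.single (z t.succ) (1 : ℝ) : Idx M L → ℝ) j) = gridE S P X y L (t + 1) ω j := by
  classical
  -- The factor at step `k` carries the likelihood when `k ≤ t` and the indicator of the state `j`
  -- when `k = t`. The weighted path sum thus becomes an iterate of the matrices `diag (c k) P`.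
  set c : ℕ → Idx M L → ℝ := fun k i =>
    (if k ≤ t then S.lik k (S.center L i) (y k ω) else 1) *
      (if k = t then (if i = j then 1 else 0) else 1) with hc
  set Q : ℕ → Matrix (Idx M L) (Idx M L) ℝ := fun k =>
    Matrix.diagonal (c k) * transMatrix S P X L with hQ
  have hprod : ∀ z : Fin (T + 2) → Idx M L, ∏ k : Fin (T + 1), c k (z k.succ) =
      auxLik S y L T t (ω, z) * (Pi.single (z t.succ) (1 : ℝ) : Idx M L → ℝ) j := by
    intro z
    rw [Finset.prod_mul_distrib]
    congr 1
    · rw [auxLik, ← Finset.prod_filter]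
      refine Finset.prod_congr ?_ fun _ _ => rfl
      ext k
      simp only [Finset.mem_Iic, Finset.mem_filter, Finset.mem_univ, true_and, Fin.le_def]
    · simp only [Fin.val_inj]
      rw [Finset.prod_ite_eq' Finset.univ t]
      simp [Pi.single_apply, eq_comm]
  have hsum := sum_paths_eq Q (initVec S P X L) (T + 1) fun _ => 1
  have hstep : ∀ k v, Q k *ᵥ v = fun i => c k i * (transMatrix S P X L *ᵥ v) i := by
    intro k v
    rw [hQ, ← Matrix.mulVec_mulVec]
    exact funext fun i => Matrix.mulVec_diagonal _ _ _
  have hbefore : ∀ k, k ≤ (t : ℕ) → mulVecIter Q (initVec S P X L) k = gridE S P X y L k ω := by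
    intro k
    induction k with
    | zero => exact fun _ => rfl
    | succ k ih =>
      intro hk
      rw [mulVecIter, ih (by omega), hstep, gridE, System.likMatrix]
      funext i
      rw [Matrix.mulVec_diagonal, hc]
      simp only
      rw [if_pos (by omega), if_neg (by omega), mul_one]
  -- The indicator keeps only the entry `j` of the recursion at time `t`.
  have hat : mulVecIter Q (initVec S P X L) (t + 1) = Pi.single j (gridE S P X y L (t + 1) ω j) := by
    rw [mulVecIter, hbefore _ le_rfl, hstep]
    funext i
    rw [hc]
    simp only [le_refl, if_true]
    by_cases hij : i = j
    · subst hij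
      rw [Pi.single_eq_same, if_pos rfl, mul_one, gridE, System.likMatrix, Matrix.mulVec_diagonal]
    · rw [Pi.single_eq_of_ne hij, if_neg hij, mul_zero, zero_mul]
  -- Later steps are plain transitions, which do not change the total mass.
  have hafter : ∀ r, S.SupportedOn (P.map (X 0)) (mulVecIter Q (initVec S P X L) (t + 1 + r)) ∧
      ∑ i, mulVecIter Q (initVec S P X L) (t + 1 + r) i = gridE S P X y L (t + 1) ω j := by
    intro r
    induction r with
    | zero =>
      rw [add_zero, hat]
      refine ⟨fun i hi => ?_, by simp⟩
      by_cases hij : i = j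
      · subst hij
        rw [Pi.single_eq_same]
        exact supportedOn_gridE hS h hL _ ω i hi
      · exact Pi.single_eq_of_ne hij _
    | succ r ih =>
      have h1 : mulVecIter Q (initVec S P X L) (t + 1 + (r + 1)) =
          transMatrix S P X L *ᵥ mulVecIter Q (initVec S P X L) (t + 1 + r) := by
        rw [← add_assoc, mulVecIter, hstep]
        funext i
        rw [hc]
        simp only
        rw [if_neg (by omega), if_neg (by omega), one_mul, one_mul]
      rw [h1]
      exact ⟨supportedOn_transMatrix_mulVec hS h hL _,
        (sum_transMatrix_mulVec hS h hL ih.1).trans ih.2⟩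
  clear_value c
  obtain ⟨r, hr⟩ := Nat.exists_eq_add_of_le (show (t : ℕ) + 1 ≤ T + 1 by omega)
  rw [hr] at hsum
  rw [← (hafter r).2]
  simp only [mul_one] at hsum
  rw [← hr] at hsum ⊢
  rw [← hsum]
  refine Finset.sum_congr rfl fun z _ => ?_
  rw [← hprod, chainWeight]
  have h2 : ∀ k : Fin (T + 1), Q k (z k.succ) (z k.castSucc) =
      c k (z k.succ) * transMatrix S P X L (z k.succ) (z k.castSucc) := fun k =>
    Matrix.diagonal_mul _ _ _ _
  rw [Finset.prod_congr rfl fun k _ => h2 k, Finset.prod_mul_distrib]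
  ring

lemma sum_chainWeight [IsProbabilityMeasure P] (hS : S.Regular) (h : IsRealization S P X y)
    (hL : 1 ≤ L) (T : ℕ) : ∑ z, chainWeight S P X L T z = 1 := by
  have hsum := sum_paths_eq (fun _ => transMatrix S P X L) (initVec S P X L) (T + 1) fun _ => 1
  simp only [mul_one] at hsum
  have h1 : ∀ n, S.SupportedOn (P.map (X 0))
      (mulVecIter (fun _ => transMatrix S P X L) (initVec S P X L) n) ∧
      ∑ i, mulVecIter (fun _ => transMatrix S P X L) (initVec S P X L) n i = 1 := by
    intro n
    induction n with
    | zero => exact ⟨fun j hj => (initVec_apply hS h hL j).trans hj, sum_initVec hS h hL⟩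
    | succ n ih =>
      exact ⟨supportedOn_transMatrix_mulVec hS h hL _,
        (sum_transMatrix_mulVec hS h hL ih.1).trans ih.2⟩
  exact hsum.trans (h1 _).2

lemma integral_chainLaw {E : Type*} [NormedAddCommGroup E] [NormedSpace ℝ E] [CompleteSpace E]
    (T : ℕ) (f : (Fin (T + 2) → Idx M L) → E) :
    ∫ z, f z ∂(chainLaw S P X L T) = ∑ z, chainWeight S P X L T z • f z := by
  rw [chainLaw, integral_finsetSum_measure fun z _ =>
    (Integrable.of_finite (μ := Measure.dirac z)).smul_measure ENNReal.ofReal_ne_top]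
  refine Finset.sum_congr rfl fun z _ => ?_
  rw [integral_smul_measure, integral_dirac, ← chainWeight,
    ENNReal.toReal_ofReal (chainWeight_nonneg T z)]

lemma isProbabilityMeasure_chainLaw [IsProbabilityMeasure P] (hS : S.Regular)
    (h : IsRealization S P X y) (hL : 1 ≤ L) (T : ℕ) :
    IsProbabilityMeasure (chainLaw S P X L T) := by
  constructor
  simp only [chainLaw, Measure.coe_finsetSum, Finset.sum_apply, Measure.smul_apply,
    measure_univ, smul_eq_mul, mul_one]
  change ∑ z, ENNReal.ofReal (chainWeight S P X L T z) = 1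
  rw [← ENNReal.ofReal_sum_of_nonneg fun z _ => chainWeight_nonneg T z]
  exact (congrArg ENNReal.ofReal (sum_chainWeight hS h hL T)).trans ENNReal.ofReal_one

end chain

/-! ### Conditional expectation in a product with a finite space -/

/-- Since the second factor is independent of the first, it is integrated out. Sets of the
pulled-back σ-algebra are cylinders `G × Z`, on which Fubini applies; finiteness of `Z` makes the
candidate `m`-measurable. -/
lemma condExp_prod_finite {Ω Z E : Type*} {m m₀ : MeasurableSpace Ω} [Finite Z] [MeasurableSpace Z]
    [MeasurableSingletonClass Z] [NormedAddCommGroup E] [NormedSpace ℝ E] [CompleteSpace E]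
    {μ : Measure Ω} [IsFiniteMeasure μ] {η : Measure Z} [IsProbabilityMeasure η]
    (hm : m ≤ m₀) {F : Ω × Z → E}
    (hF : ∀ z, StronglyMeasurable[m] fun ω => F (ω, z)) {B : ℝ} (hB : ∀ p, ‖F p‖ ≤ B) :
    (fun p => ∫ z, F (p.1, z) ∂η) =ᵐ[μ.prod η] (μ.prod η)[F | m.comap Prod.fst] := by
  classical
  have := Fintype.ofFinite Z
  have hle : m.comap Prod.fst ≤ (Prod.instMeasurableSpace : MeasurableSpace (Ω × Z)) :=
    (MeasurableSpace.comap_mono hm).trans measurable_fst.comap_le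
  have hFm : StronglyMeasurable F := by
    have h1 : F = fun p => ∑ z, if p.2 = z then F (p.1, z) else 0 := by
      funext p
      simp
    rw [h1]
    exact Finset.stronglyMeasurable_fun_sum _ fun z _ => StronglyMeasurable.ite
      (measurable_snd (measurableSet_singleton z))
      (((hF z).mono hm).comp_measurable measurable_fst) stronglyMeasurable_const
  have hFi : Integrable F (μ.prod η) := .of_bound hFm.aestronglyMeasurable B (ae_of_all _ hB)
  have hG : StronglyMeasurable[m] fun ω => ∫ z, F (ω, z) ∂η := by
    have h1 : (fun ω => ∫ z, F (ω, z) ∂η) = fun ω => ∑ z, η.real {z} • F (ω, z) :=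
      funext fun ω => integral_fintype .of_finite
    rw [h1]
    exact Finset.stronglyMeasurable_fun_sum _ fun z _ => (hF z).const_smul _
  have hGB : ∀ ω, ‖∫ z, F (ω, z) ∂η‖ ≤ B := fun ω => by
    simpa using norm_integral_le_of_norm_le_const (μ := η) (ae_of_all _ fun z => hB (ω, z))
  have hGi : Integrable (fun p : Ω × Z => ∫ z, F (p.1, z) ∂η) (μ.prod η) :=
    .of_bound ((hG.mono hm).comp_measurable measurable_fst).aestronglyMeasurable B
      (ae_of_all _ fun p => hGB p.1)
  refine ae_eq_condExp_of_forall_setIntegral_eq hle hFi (fun s _ _ => hGi.integrableOn) ?_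
    (hG.comp_measurable (comap_measurable Prod.fst)).aestronglyMeasurable
  rintro _ ⟨G, hG', rfl⟩ -
  have hs : (Prod.fst ⁻¹' G : Set (Ω × Z)) = G ×ˢ Set.univ := by ext; simp
  rw [hs, setIntegral_prod _ hGi.integrableOn, setIntegral_prod _ hFi.integrableOn]
  simp

/-! ### The approximate filter of the auxiliary chain -/

section auxiliary

variable {S : System M N} {P : Measure Ω} {X : ℕ → Ω → (Fin M → ℝ)} {y : ℕ → Ω → (Fin N → ℝ)}
  {L : ℕ}

lemma abs_auxLik_le_one {Ω : Type*} {y : ℕ → Ω → (Fin N → ℝ)} (hS : S.Regular) (T : ℕ) (t : Fin (T + 1))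
    (p : Ω × (Fin (T + 2) → Idx M L)) : |auxLik S y L T t p| ≤ 1 := by
  rw [auxLik, Finset.abs_prod]
  refine Finset.prod_le_one (fun _ _ => abs_nonneg _) fun i _ => ?_
  rw [abs_of_pos (System.lik_pos hS i (center_mem_cube hS.lt _) _)]
  exact System.lik_le_one hS i (center_mem_cube hS.lt _) _

lemma measurable_auxLik {Ω : Type*} {y : ℕ → Ω → (Fin N → ℝ)} (T : ℕ) (t : Fin (T + 1)) (z : Fin (T + 2) → Idx M L) :
    Measurable[history y t] fun ω => auxLik S y L T t (ω, z) := by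
  unfold auxLik
  refine Finset.measurable_fun_prod _ fun i hi => ?_
  have h1 : Measurable[history y t] (y i) := measurable_history y (Fin.le_def.1 (Finset.mem_Iic.1 hi))
  have h2 := (System.measurable_lik S i (S.center L (z i.succ))).comp h1
  exact h2

lemma auxE_ae_eq [IsProbabilityMeasure P] (hS : S.Regular) (h : IsRealization S P X y)
    (hL : 1 ≤ L) (T : ℕ) (t : Fin (T + 1)) :
    ∀ᵐ p ∂(auxMeasure S P X y L T), auxE S P X y L T t p = gridE S P X y L (t + 1) p.1 := by
  have := isFiniteMeasure_refMeasure hS h T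
  have := isProbabilityMeasure_chainLaw hS h hL T
  have h1 := condExp_prod_finite (μ := refMeasure S P X y T) (η := chainLaw S P X L T)
    (history_le h.measurable_obs t) (B := 1)
    (F := fun p => auxLik S y L T t p • (Pi.single (p.2 t.succ) (1 : ℝ) : Idx M L → ℝ))
    (fun z => (measurable_auxLik (S := S) (y := y) T t z).stronglyMeasurable.smul_const
      (Pi.single (z t.succ) (1 : ℝ) : Idx M L → ℝ)) fun p => by
      rw [norm_smul, Pi.norm_single, norm_one, mul_one]
      exact abs_auxLik_le_one hS T t p
  filter_upwards [h1] with p hp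
  refine hp.symm.trans ?_
  rw [integral_chainLaw]
  funext j
  rw [← sum_chainWeight_lik hS h hL T t p.1 j, Finset.sum_apply]
  rfl

lemma auxNorm_ae_eq [IsProbabilityMeasure P] (hS : S.Regular) (h : IsRealization S P X y)
    (hL : 1 ≤ L) (T : ℕ) (t : Fin (T + 1)) :
    ∀ᵐ p ∂(auxMeasure S P X y L T),
      auxNorm S P X y L T t p = l1 (gridE S P X y L (t + 1) p.1) := by
  have := isFiniteMeasure_refMeasure hS h T
  have := isProbabilityMeasure_chainLaw hS h hL T
  have h1 := condExp_prod_finite (μ := refMeasure S P X y T) (η := chainLaw S P X L T)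
    (history_le h.measurable_obs t) (B := 1) (F := fun p => auxLik S y L T t p)
    (fun z => (measurable_auxLik T t z).stronglyMeasurable) fun p => abs_auxLik_le_one hS T t p
  filter_upwards [h1] with p hp
  refine hp.symm.trans ?_
  rw [integral_chainLaw, l1_gridE hS h hL,
    Finset.sum_congr rfl fun j _ => (sum_chainWeight_lik hS h hL T t p.1 j).symm,
    Finset.sum_comm]
  refine Finset.sum_congr rfl fun z _ => ?_
  -- The entries of a basis vector sum to `1`.
  rw [← Finset.mul_sum, ← Finset.mul_sum, Finset.sum_pi_single']
  simp

lemma aux_ae_eq [IsProbabilityMeasure P] (hS : S.Regular) (h : IsRealization S P X y)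
    (hL : 1 ≤ L) (T : ℕ) (t : Fin (T + 1)) : ∀ᵐ p ∂(auxMeasure S P X y L T),
      auxE S P X y L T t p = gridE S P X y L (t + 1) p.1 ∧
        0 < l1 (gridE S P X y L (t + 1) p.1) ∧
        auxFilter S P X y L T t p = gridFilter S P X y L t p.1 := by
  filter_upwards [auxE_ae_eq hS h hL T t, auxNorm_ae_eq hS h hL T t] with p h1 h2
  refine ⟨h1, ?_, ?_⟩
  · rw [l1_gridE hS h hL]
    exact sum_gridE_pos hS h hL _ _
  · rw [auxFilter, gridFilter, h1, h2]

lemma eq_of_measurable_comap {α β γ : Type*} [MeasurableSpace α] [MeasurableSpace γ]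
    [MeasurableSingletonClass γ] {f : β → α} {g : β → γ}
    (hg : Measurable[MeasurableSpace.comap f inferInstance] g) {b b' : β} (h : f b = f b') :
    g b = g b' := by
  obtain ⟨A, -, hA⟩ := hg (measurableSet_singleton (g b'))
  have : b' ∈ f ⁻¹' A := hA ▸ (rfl : g b' = g b')
  have hb : b ∈ f ⁻¹' A := by rwa [Set.mem_preimage, h]
  rw [hA] at hb
  exact hb

/-- Any version of these conditional expectations is measurable for a σ-algebra pulled back from
`Ω`, so it cannot depend on the path of the chain at any point. -/
lemma auxFilter_congr (T : ℕ) (t : Fin (T + 1)) {p p' : Ω × (Fin (T + 2) → Idx M L)}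
    (h : p.1 = p'.1) : auxFilter S P X y L T t p = auxFilter S P X y L T t p' := by
  have h1 : auxE S P X y L T t p = auxE S P X y L T t p' :=
    @eq_of_measurable_comap _ _ _ (history y t) _ _ _ _ stronglyMeasurable_condExp.measurable _ _ h
  have h2 : auxNorm S P X y L T t p = auxNorm S P X y L T t p' :=
    @eq_of_measurable_comap _ _ _ (history y t) _ _ _ _ stronglyMeasurable_condExp.measurable _ _ h
  rw [auxFilter, auxFilter, h1, h2]

/-- Fubini gives, for almost every `ω`, some path with equality, and `auxFilter_congr` extends it to
all paths, including those of probability zero. Null sets of the reference measure are null for `P`.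
-/
lemma auxFilter_eq_gridFilter [IsProbabilityMeasure P] (hS : S.Regular)
    (h : IsRealization S P X y) (T : ℕ) : ∀ᵐ ω ∂P, ∀ L : ℕ, 1 ≤ L → ∀ (t : Fin (T + 1))
      (z : Fin (T + 2) → Idx M L),
        auxFilter S P X y L T t (ω, z) = gridFilter S P X y L t ω := by
  refine ae_all_iff.2 fun L => ?_
  by_cases hL : 1 ≤ L
  · have := isProbabilityMeasure_chainLaw hS h hL T
    have := isFiniteMeasure_refMeasure hS h T
    refine (absolutelyContinuous_refMeasure hS h T).ae_le ?_
    have h1 := Measure.ae_ae_of_ae_prod (ae_all_iff.2 fun t => aux_ae_eq hS h hL T t)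
    filter_upwards [h1] with ω hω _ t z
    obtain ⟨z', hz'⟩ := hω.exists
    have h2 : auxFilter S P X y L T t (ω, z) = auxFilter S P X y L T t (ω, z') :=
      auxFilter_congr T t rfl
    exact h2.trans (hz' t).2.2
  · exact ae_of_all _ fun ω h => absurd h hL

end auxiliary

/-! ### Uniform convergence -/

section uniform

variable {S : System M N} {P : Measure Ω} {X : ℕ → Ω → (Fin M → ℝ)} {y : ℕ → Ω → (Fin N → ℝ)}

lemma measurable_gridE (h : IsRealization S P X y) (L t : ℕ) :
    Measurable (gridE S P X y L t) := by
  induction t with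
  | zero => exact measurable_const
  | succ t ih =>
    refine measurable_pi_lambda _ fun i => ?_
    simp only [gridE, System.likMatrix, Matrix.mulVec_diagonal]
    simp only [Matrix.mulVec, dotProduct]
    exact ((System.measurable_lik S t _).comp (h.measurable_obs t)).mul
      (Finset.measurable_fun_sum _ fun j _ => ((measurable_pi_apply j).comp ih).const_mul _)

lemma measurable_l1 {ι : Type*} [Fintype ι] : Measurable (l1 : (ι → ℝ) → ℝ) := by
  unfold l1
  fun_prop

lemma measurable_gridFilter (h : IsRealization S P X y) (L t : ℕ) :
    Measurable (gridFilter S P X y L t) := by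
  refine measurable_pi_lambda _ fun m => ?_
  simp only [gridFilter, Pi.smul_apply, smul_eq_mul, Matrix.mulVec, dotProduct]
  exact (measurable_l1.comp (measurable_gridE h L (t + 1))).inv.mul
    (Finset.measurable_fun_sum _ fun j _ =>
      ((measurable_pi_apply j).comp (measurable_gridE h L (t + 1))).const_mul _)

lemma measurable_mmse (h : IsRealization S P X y) (t : ℕ) : Measurable (mmse P X y t) :=
  (stronglyMeasurable_condExp.mono (history_le h.measurable_obs t)).measurable

lemma tendsto_zero_of_forall_eventually_le_ofReal {f : ℕ → ℝ≥0∞}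
    (h : ∀ ε : ℝ, 0 < ε → ∀ᶠ n in atTop, f n ≤ ENNReal.ofReal ε) :
    Tendsto f atTop (𝓝 0) := by
  refine ENNReal.tendsto_nhds_zero.2 fun ε hε => ?_
  by_cases hε' : ε = ∞
  · exact .of_forall fun n => hε' ▸ le_top
  · have := h ε.toReal (ENNReal.toReal_pos hε.ne' hε')
    rwa [ENNReal.ofReal_toReal hε'] at this

/-- The set of outcomes on which the grid filters converge uniformly to the optimal filter, and
on which the approximate filters agree with the grid filters. -/
lemma exists_uniform_convergence_set [IsProbabilityMeasure P] (hS : S.Regular)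
    (h : IsRealization S P X y)
    (hreg : IsCRT1 S (P.map (X 0)) ∨ IsCRT2 S (P.map (X 0))) (T : ℕ) {ε : ℝ} (hε : 0 < ε) :
    ∃ A : Set Ω, MeasurableSet A ∧ 1 - ε ≤ P.real A ∧
      (∀ r : ℝ, 0 < r → ∀ᶠ L : ℕ in atTop, ∀ t : Fin (T + 1), ∀ ω ∈ A,
        l1 (gridFilter S P X y L t ω - mmse P X y t ω) ≤ r) ∧
      ∀ ω ∈ A, ∀ L : ℕ, 1 ≤ L → ∀ (t : Fin (T + 1)) (z : Fin (T + 2) → Idx M L),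
        auxFilter S P X y L T t (ω, z) = gridFilter S P X y L t ω := by
  set f : ℕ → Ω → ℝ := fun L ω =>
    ∑ t : Fin (T + 1), l1 (gridFilter S P X y L t ω - mmse P X y t ω) with hf
  have hfm : ∀ L, StronglyMeasurable (f L) := fun L =>
    (Finset.measurable_fun_sum Finset.univ fun (t : Fin (T + 1)) _ => measurable_l1.comp
      ((measurable_gridFilter h L t).sub (measurable_mmse h t))).stronglyMeasurable
  have hlim : ∀ᵐ ω ∂P, Tendsto (fun L => f L ω) atTop (𝓝 0) := by
    filter_upwards [ae_all_iff.2 fun t : Fin (T + 1) =>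
      ae_tendsto_l1_gridFilter hS h hreg (t : ℕ)] with ω hω
    simpa using tendsto_finsetSum Finset.univ fun t _ => hω t
  -- Egorov's theorem; since `f` sums over the times up to `T`, one exceptional set serves all of
  -- them.
  obtain ⟨B, hBm, hBP, hB⟩ := tendstoUniformlyOn_of_ae_tendsto' hfm
    (stronglyMeasurable_const (b := (0 : ℝ))) hlim hε
  have haux := auxFilter_eq_gridFilter hS h T
  -- The null set where the two filters differ for some `L`, `t` or path is removed as well, at no
  -- cost in probability.
  obtain ⟨D, hD, hDm, hDP⟩ := exists_measurable_superset_of_null (ae_iff.1 haux)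
  refine ⟨(B ∪ D)ᶜ, (hBm.union hDm).compl, ?_, fun r hr => ?_, fun ω hω => ?_⟩
  · rw [probReal_compl_eq_one_sub (hBm.union hDm)]
    have h1 : P (B ∪ D) ≤ ENNReal.ofReal ε := by
      refine (measure_union_le _ _).trans ?_
      rwa [hDP, add_zero]
    have h2 := ENNReal.toReal_mono ENNReal.ofReal_ne_top h1
    rw [ENNReal.toReal_ofReal hε.le] at h2
    exact sub_le_sub_left h2 1
  · filter_upwards [Metric.tendstoUniformlyOn_iff.1 hB r hr] with L hL t ω hω
    have h1 := hL ω fun h' => hω (Or.inl h')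
    rw [dist_comm, Real.dist_eq, sub_zero] at h1
    refine le_trans ?_ ((le_abs_self _).trans h1.le)
    exact Finset.single_le_sum
      (f := fun t : Fin (T + 1) => l1 (gridFilter S P X y L t ω - mmse P X y t ω))
      (fun t _ => Finset.sum_nonneg fun _ _ => abs_nonneg _) (Finset.mem_univ t)
  · by_contra hcon
    exact hω (Or.inr (hD hcon))

end uniform

end GridFilter

end

theorem theorem4 {M N : ℕ} {Ω : Type*} [MeasurableSpace Ω] (P : Measure Ω)
    [IsProbabilityMeasure P] (S : System M N) (X : ℕ → Ω → (Fin M → ℝ))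
    (y : ℕ → Ω → (Fin N → ℝ)) (hS : S.Regular) (hXy : IsRealization S P X y)
    (hreg : IsCRT1 S (P.map (X 0)) ∨ IsCRT2 S (P.map (X 0))) :
    -- the transition matrix is time invariant, and it is the matrix of the probabilities
    -- of passing from one cell to another
    (∀ L : ℕ, 1 ≤ L → ∀ (t : ℕ) (i j : Idx M L),
      transMatrix S P X L i j =
          (ProbabilityTheory.cond P {ω | marginal S L X t ω = S.center L j}).real
            {ω | marginal S L X (t + 1) ω = S.center L i} ∧
        transMatrix S P X L i j =
          (ProbabilityTheory.cond P (X t ⁻¹' S.cell L j)).real (X (t + 1) ⁻¹' S.cell L i)) ∧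
    ∀ T : ℕ,
      -- the approximate filter is computed by the linear recursion
      (∀ L : ℕ, 1 ≤ L → ∀ t : Fin (T + 1), ∀ᵐ p ∂(auxMeasure S P X y L T),
        auxE S P X y L T t p = gridE S P X y L (t + 1) p.1 ∧
        0 < l1 (gridE S P X y L (t + 1) p.1) ∧
        auxFilter S P X y L T t p = gridFilter S P X y L t p.1) ∧
      -- asymptotic optimality
      ∀ C : ℝ, 1 ≤ C → ∃ Ωhat : Set Ω, MeasurableSet Ωhat ∧
        1 - ((T : ℝ) + 1) ^ (1 - C * N) * Real.exp (-(C * N)) ≤ P.real Ωhat ∧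
        Tendsto (fun L : ℕ => ⨆ t : Fin (T + 1), ⨆ ω ∈ Ωhat,
          ENNReal.ofReal (l1 (gridFilter S P X y L t ω - mmse P X y t ω))) atTop (𝓝 0) ∧
        Tendsto (fun L : ℕ => ⨆ t : Fin (T + 1),
          ⨆ p ∈ Ωhat ×ˢ (Set.univ : Set (Fin (T + 2) → Idx M L)),
            ENNReal.ofReal (l1 (auxFilter S P X y L T t p - mmse P X y t p.1)))
          atTop (𝓝 0) := by
  refine ⟨fun L hL t i j => ⟨?_, ?_⟩, fun T => ⟨fun L hL t => aux_ae_eq hS hXy hL T t, ?_⟩⟩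
  · rw [transMatrix_apply hS hXy hL, cond_marginal_real hS hXy hL t i j]
  · rw [transMatrix_apply hS hXy hL,
      cond_state_real hS hXy t (measurableSet_cell S L i) (measurableSet_cell S L j)]
  · intro C _
    -- The permitted exceptional probability enters Egorov's theorem only as a positive number.
    have hε : 0 < ((T : ℝ) + 1) ^ (1 - C * N) * Real.exp (-(C * N)) :=
      mul_pos (Real.rpow_pos_of_pos (by positivity) _) (Real.exp_pos _)
    obtain ⟨A, hA, hPA, hlim, haux⟩ := exists_uniform_convergence_set hS hXy hreg T hε
    refine ⟨A, hA, hPA, ?_, ?_⟩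
    · refine tendsto_zero_of_forall_eventually_le_ofReal fun r hr => ?_
      filter_upwards [hlim r hr] with L hL
      exact iSup_le fun t => iSup₂_le fun ω hω => ENNReal.ofReal_le_ofReal (hL t ω hω)
    · refine tendsto_zero_of_forall_eventually_le_ofReal fun r hr => ?_
      filter_upwards [hlim r hr, eventually_ge_atTop 1] with L hL hL1
      refine iSup_le fun t => iSup₂_le fun p hp => ENNReal.ofReal_le_ofReal ?_
      rw [show auxFilter S P X y L T t p = gridFilter S P X y L t p.1 from
        haux p.1 hp.1 L hL1 t p.2]
      exact hL t p.1 hp.1
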